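/- Let $\Gamma\subset\mathbb R^3$ be a closed (compact, embedded) $C^2$ surface. At every $y\in\Gamma$ let $\tau_1(y),\tau_2(y)$ be orthonormal tangent vectors of $\Gamma$ (no continuity in $y$ is required), and put $n=\tau_1\times\tau_2$. For $\kappa>0$ let $$G^\kappa(x,y)=\frac{e^{\mathrm i\kappa|x-y|}}{4\pi|x-y|},\qquad x\neq y.$$ Let $ds$ be the surface measure and let $\mathrm{Grad}$ and $\mathrm{Div}$ be the surface gradient and surface divergence on $\Gamma$. Call a kernel $K(x,y)$ on $\Gamma$ weakly singular if for each $x\in\Gamma$ it is continuous in $y\in\Gamma\setminus\{x\}$ and there are constants $M$ and $\beta>0$ such that $|K(x,y)|\le M|x-y|^{\beta-2}$ for all $x\ne y$ in $\Gamma$. Then, for $i=1,2$ and $x\in\Gamma$, the tangential field $y\mapsto n(y)\times\tau_i(x)\times n(y)$ is differentiable along $\Gamma$, and the three kernels $$G^\kappa(x,y)\,\mathrm{Div}_y\big(n(y)\times\tau_i(x)\times n(y)\big),\qquad G^\kappa(x,y)\,\big(n(y)\times\tau_i(x)\times n(y)\big),\qquad \frac{\partial G^\kappa(x,y)}{\partial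 n(y)}\,n(y)$$ are weakly singular. Moreover, let $0<\alpha<1$ and let $\sigma:\Gamma\to\mathbb C$ belong to $C^{1,\alpha}(\Gamma)$, that is, $\sigma$ is differentiable along $\Gamma$ and $\mathrm{Grad}\,\sigma$ is uniformly Hölder continuous with exponent $\alpha$. Then for $i=1,2$ and every $x\in\Gamma$ the Cauchy principal value on the left-hand side below exists, the three integrals on the right-hand side converge absolutely, and $$\lim_{\varepsilon\to0^+}\int_{\{y\in\Gamma:\,|x-y|>\varepsilon\}}\frac{\partial G^\kappa(x,y)}{\partial\tau_i(x)}\,\sigma(y)\,ds_y=\int_\Gamma G^\kappa(x,y)\,\mathrm{Div}_y\big(n(y)\times\tau_i(x)\times n(y)\big)\,\sigma(y)\,ds_y$$ $$\qquad+\int_\Gamma G^\kappa(x,y)\,\big(n(y)\times\tau_i(x)\times n(y)\big)\cdot\mathrm{Grad}_y\,\sigma(y)\,ds_y-\tau_i(x)\cdot\int_\Gamma\frac{\partial G^\kappa(x,y)}{\partial n(y)}\,n(y)\,\sigma(y)\,ds_y .$$ Here the integrals over $\{|x-y|>\varepsilon\}$ converge absolutely for every $\varepsilon>0$. -/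

import Mathlib

open MeasureTheory Filter Topology

namespace LayerPotential

/-- Euclidean three-space. -/
abbrev E3 : Type := EuclideanSpace ℝ (Fin 3)

/-- Complex vectors with three components (Hermitian norm). -/
abbrev C3 : Type := EuclideanSpace ℂ (Fin 3)

/-- The cross product `a × b` on Euclidean three-space. -/
noncomputable def cross (a b : E3) : E3 :=
  WithLp.toLp 2 (crossProduct (WithLp.ofLp a) (WithLp.ofLp b))

/-- A real vector regarded as a complex vector. -/
noncomputable def toC (v : E3) : C3 := WithLp.toLp 2 fun j => (v j : ℂ)

/-- The bilinear dot product `v · w` of a real vector with a complex vector. -/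
noncomputable def cdot (v : E3) (w : C3) : ℂ := ∑ j, (v j : ℂ) * w j

/-- A closed `C²` surface: a compact subset of three-space which near each of its points is carried
onto a piece of the plane `z₃ = 0` by a `C²` diffeomorphism between open sets of three-space. -/
structure IsClosedC2Surface (Γ : Set E3) : Prop where
  isCompact : IsCompact Γ
  flatten : ∀ p ∈ Γ, ∃ Φ : OpenPartialHomeomorph E3 E3, p ∈ Φ.source ∧
    ContDiffOn ℝ 2 Φ Φ.source ∧ ContDiffOn ℝ 2 Φ.symm Φ.target ∧
    ∀ y ∈ Φ.source, y ∈ Γ ↔ Φ y 2 = 0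

/-- The tangent space `T_y Γ`, as a linear subspace of three-space. -/
def tangentPlane (Γ : Set E3) (y : E3) : Submodule ℝ E3 :=
  Submodule.span ℝ (tangentConeAt ℝ Γ y)

/-- The differential at `y` of a map `f` defined on `Γ`: a derivative of `f` along `Γ`, precomposed
with the orthogonal projection onto `T_y Γ`. Only the values of `f` on `Γ` matter if `y ∈ Γ`, and
derivatives along `Γ` agree on `T_y Γ`, so that no choice is left. -/
noncomputable def surfDeriv {F : Type*} [NormedAddCommGroup F] [NormedSpace ℝ F]
    (Γ : Set E3) (f : E3 → F) (y : E3) : E3 →L[ℝ] F :=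
  (fderivWithin ℝ f Γ y).comp (tangentPlane Γ y).starProjection

/-- The surface gradient `Grad σ (y)`, the tangential vector that represents the differential:
`surfDeriv Γ σ y v = v · Grad σ (y)`. -/
noncomputable def surfGrad (Γ : Set E3) (σ : E3 → ℂ) (y : E3) : C3 :=
  WithLp.toLp 2 fun j => surfDeriv Γ σ y (EuclideanSpace.single j 1)

/-- The surface divergence `Div J (y)`, the trace of the differential of `J`:
the sum of `t · ∂_t J (y)` over an orthonormal basis of `T_y Γ`. -/
noncomputable def surfDiv (Γ : Set E3) (J : E3 → E3) (y : E3) : ℝ :=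
  ∑ j, surfDeriv Γ J y (EuclideanSpace.single j 1) j

/-- `σ ∈ C^{1,α}(Γ)`: `σ` is differentiable along `Γ`, with Hölder continuous surface gradient.
(If `Γ` is compact, then `σ` and `Grad σ` are bounded.) -/
def IsC1Holder (Γ : Set E3) (α : ℝ) (σ : E3 → ℂ) : Prop :=
  (∀ y ∈ Γ, DifferentiableWithinAt ℝ σ Γ y) ∧
  ∃ C : ℝ, ∀ y ∈ Γ, ∀ z ∈ Γ, ‖surfGrad Γ σ y - surfGrad Γ σ z‖ ≤ C * ‖y - z‖ ^ α

/-- `τ 0`, `τ 1` are the unit tangential vectors of `Γ`: at every point of `Γ` they form an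
orthonormal pair in the tangent space. No continuity is asked for. -/
def IsTangentFrame (Γ : Set E3) (τ : Fin 2 → E3 → E3) : Prop :=
  ∀ y ∈ Γ, (∀ i, τ i y ∈ tangentPlane Γ y) ∧ Orthonormal ℝ fun i => τ i y

/-- The normal `n = τ₁ × τ₂`. -/
noncomputable def normal (τ : Fin 2 → E3 → E3) (y : E3) : E3 := cross (τ 0 y) (τ 1 y)

/-- The tangential field `y ↦ n(y) × a × n(y)` of a fixed vector `a`; the triple product
does not depend on the bracketing. -/
noncomputable def tangential (τ : Fin 2 → E3 → E3) (a : E3) (y : E3) : E3 :=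
  cross (cross (normal τ y) a) (normal τ y)

/-- The free space Green's function `exp(iκ|x-y|) / (4π|x-y|)` of the Helmholtz equation. -/
noncomputable def G (κ : ℝ) (x y : E3) : ℂ :=
  Complex.exp (Complex.I * κ * ‖x - y‖) / (4 * Real.pi * ‖x - y‖)

/-- The derivative of `G κ x y` with respect to `x` in direction `v`. -/
noncomputable def dGx (κ : ℝ) (x y v : E3) : ℂ := fderiv ℝ (fun z => G κ z y) x v

/-- The derivative of `G κ x y` with respect to `y` in direction `v`. -/
noncomputable def dGy (κ : ℝ) (x y v : E3) : ℂ := fderiv ℝ (fun z => G κ x z) y v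

/-- Integration over `Γ` is with respect to surface area: the two-dimensional Hausdorff measure
with the normalization that makes it agree with Lebesgue measure on planes. -/
noncomputable def area (Γ : Set E3) : Measure E3 := (μHE[2] : Measure E3).restrict Γ

/-- `K` is a weakly singular kernel on `Γ`: it is continuous in `y` off the diagonal and
`O(|x-y|^(β-2))` uniformly, for some `β > 0`. -/
def IsWeaklySingular {F : Type*} [NormedAddCommGroup F] (Γ : Set E3) (K : E3 → E3 → F) : Prop :=
  (∀ x ∈ Γ, ContinuousOn (K x) (Γ \ {x})) ∧
  ∃ M β : ℝ, 0 < β ∧ ∀ x ∈ Γ, ∀ y ∈ Γ, y ≠ x → ‖K x y‖ ≤ M * ‖x - y‖ ^ (β - 2)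

end LayerPotential

open LayerPotential

namespace LayerPotential

/-! Fix `x` and `a = τ i x`, and let `J = n × a × n`, the orthogonal projection of `a` to the
tangent planes. Freeze the kernel near the singularity: replace `|x-y|` in `G` by `max ε |x-y|`. The
frozen kernel `G_ε` is Lipschitz, equals `G` outside the `ε`-ball and is constant on the ball. On a
closed surface `∫ Div (G_ε σ J) = 0`, that is, `∫ G_ε (σ Div J + J · Grad σ) = -∫_{|x-y|>ε} σ J ·
∇_y G`. No boundary term over the circle `|x-y| = ε` arises, because the frozen kernel is continuous
across it. Since `∇_x G = -∇_y G` and `a = J + (n · a) n`, this is the asserted formula with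
truncated integrals (`setIntegral_dGx_eq`).

As `ε → 0`, dominated convergence applies to the right-hand side. A chord of a `C²` surface
satisfies `|n(y) · (x-y)| ≤ C |x-y|²` (`exists_inner_normal_le`), so the normal derivative of `G` is
`O(1/|x-y|)`, and `1/|x-y|` is integrable on a surface (`IsClosedC2Surface.integrable_norm_inv`).
The left-hand side therefore has a limit although its kernel is not absolutely integrable in
general.

Two points need care. The frame may be discontinuous, but `n` enters only through expressions even
in `n`, which are locally functions of the `C¹` gradient of a defining function
(`SurfaceChart.inner_normal_smul_normal`). The divergence theorem (`integral_div_eq_zero`) is for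
Hausdorff measure and `C¹` integrands: it is reduced to charts by cutoff functions, transferred to
the plane by `area_formula`, and there it is the vanishing of integrals of compactly supported
derivatives. The frozen kernel is only Lipschitz, so it is approached by `C¹` kernels with a second
parameter `δ → 0` (`truncated_integration_by_parts`). -/

/-- The Euclidean plane of chart parameters. -/
abbrev E2 : Type := EuclideanSpace ℝ (Fin 2)

/-! ### Cross product algebra in three-space -/

theorem cross_apply_zero (a b : E3) : cross a b 0 = a 1 * b 2 - a 2 * b 1 := by
  simp [cross, cross_apply]

theorem cross_apply_one (a b : E3) : cross a b 1 = a 2 * b 0 - a 0 * b 2 := by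
  simp [cross, cross_apply]

theorem cross_apply_two (a b : E3) : cross a b 2 = a 0 * b 1 - a 1 * b 0 := by
  simp [cross, cross_apply]

theorem inner_eq_sum (a b : E3) : inner ℝ a b = a 0 * b 0 + a 1 * b 1 + a 2 * b 2 := by
  simp [PiLp.inner_apply, Fin.sum_univ_three, mul_comm]

theorem ext_three {a b : E3} (h0 : a 0 = b 0) (h1 : a 1 = b 1) (h2 : a 2 = b 2) : a = b := by
  ext i
  fin_cases i
  exacts [h0, h1, h2]

theorem norm_cross_sq (a b : E3) :
    ‖cross a b‖ ^ 2 = ‖a‖ ^ 2 * ‖b‖ ^ 2 - inner ℝ a b ^ 2 := by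
  simp only [← real_inner_self_eq_norm_sq, inner_eq_sum, cross_apply_zero, cross_apply_one,
    cross_apply_two]
  ring

/-- Cramer's rule in the basis `b`, `c`, `b × c`. -/
theorem norm_cross_sq_smul (b c v : E3) :
    ‖cross b c‖ ^ 2 • v = inner ℝ (cross v c) (cross b c) • b +
      inner ℝ (cross b v) (cross b c) • c + inner ℝ (cross b c) v • cross b c := by
  rw [← real_inner_self_eq_norm_sq]
  refine ext_three ?_ ?_ ?_ <;>
  · simp only [inner_eq_sum, cross_apply_zero, cross_apply_one, cross_apply_two, PiLp.add_apply,
      PiLp.smul_apply, smul_eq_mul]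
    ring

/-- Cramer's rule with vanishing normal coefficient. It serves to expand tangent vectors in the
coordinate vectors of a chart. -/
theorem exists_eq_add_of_inner_cross_eq_zero {b c v : E3} (h : cross b c ≠ 0)
    (hv : inner ℝ (cross b c) v = 0) : ∃ s t : ℝ, v = s • b + t • c := by
  have h2 : ‖cross b c‖ ^ 2 ≠ 0 := by simpa using h
  refine ⟨inner ℝ (cross v c) (cross b c) / ‖cross b c‖ ^ 2,
    inner ℝ (cross b v) (cross b c) / ‖cross b c‖ ^ 2, ?_⟩
  have := norm_cross_sq_smul b c v
  rw [hv, zero_smul, add_zero] at this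
  refine (inv_smul_smul₀ h2 v).symm.trans ?_
  rw [this]
  simp only [smul_add, smul_smul, div_eq_inv_mul]

theorem eq_add_add_of_orthonormal {t : Fin 2 → E3} (ht : Orthonormal ℝ t) (v : E3) :
    v = inner ℝ (t 0) v • t 0 + inner ℝ (t 1) v • t 1 +
      inner ℝ (cross (t 0) (t 1)) v • cross (t 0) (t 1) := by
  have h0 : inner ℝ (t 0) (t 0) = (1 : ℝ) := by simp [ht.1 0]
  have h1 : inner ℝ (t 1) (t 1) = (1 : ℝ) := by simp [ht.1 1]
  have h01 : inner ℝ (t 0) (t 1) = (0 : ℝ) := ht.2 (by decide)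
  have hn : ‖cross (t 0) (t 1)‖ ^ 2 = 1 := by
    rw [norm_cross_sq, ht.1 0, ht.1 1, h01]; norm_num
  have e0 : inner ℝ (cross v (t 1)) (cross (t 0) (t 1)) =
      inner ℝ (t 0) v * inner ℝ (t 1) (t 1) - inner ℝ (t 1) v * inner ℝ (t 0) (t 1) := by
    simp only [inner_eq_sum, cross_apply_zero, cross_apply_one, cross_apply_two]
    ring
  have e1 : inner ℝ (cross (t 0) v) (cross (t 0) (t 1)) =
      inner ℝ (t 1) v * inner ℝ (t 0) (t 0) - inner ℝ (t 0) v * inner ℝ (t 0) (t 1) := by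
    simp only [inner_eq_sum, cross_apply_zero, cross_apply_one, cross_apply_two]
    ring
  have := norm_cross_sq_smul (t 0) (t 1) v
  rw [hn, one_smul, e0, e1, h0, h1, h01] at this
  simpa using this

theorem norm_cross_of_orthonormal {t : Fin 2 → E3} (ht : Orthonormal ℝ t) :
    ‖cross (t 0) (t 1)‖ = 1 := by
  have h01 : inner ℝ (t 0) (t 1) = (0 : ℝ) := ht.2 (by decide)
  have hn : ‖cross (t 0) (t 1)‖ ^ 2 = 1 := by
    rw [norm_cross_sq, ht.1 0, ht.1 1, h01]; norm_num
  exact (pow_eq_one_iff_of_nonneg (norm_nonneg _) two_ne_zero).1 hn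

/-- For a unit vector `n` this is the projection of `a` orthogonal to `n`, and it is unchanged under
`n ↦ -n`. -/
theorem cross_cross_self (n a : E3) :
    cross (cross n a) n = ‖n‖ ^ 2 • a - inner ℝ n a • n := by
  rw [← real_inner_self_eq_norm_sq]
  refine ext_three ?_ ?_ ?_ <;>
  · simp only [inner_eq_sum, cross_apply_zero, cross_apply_one, cross_apply_two, PiLp.sub_apply,
      PiLp.smul_apply, smul_eq_mul]
    ring

theorem eq_sum_single (v : E3) : v = v 0 • EuclideanSpace.single 0 (1 : ℝ) +
    v 1 • EuclideanSpace.single 1 (1 : ℝ) + v 2 • EuclideanSpace.single 2 (1 : ℝ) := by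
  refine ext_three ?_ ?_ ?_ <;> simp

/-- The infinitesimal form of `det (L b) (L c) (L d) = det L * det b c d`. -/
theorem trace_mul_inner_cross (L : E3 →L[ℝ] E3) (ν b c : E3) :
    (∑ j, L (EuclideanSpace.single j 1) j) * inner ℝ ν (cross b c) =
      inner ℝ (L ν) (cross b c) + inner ℝ ν (cross (L b) c) + inner ℝ ν (cross b (L c)) := by
  have h (v : E3) : L v = v 0 • L (EuclideanSpace.single 0 (1 : ℝ)) +
      v 1 • L (EuclideanSpace.single 1 (1 : ℝ)) + v 2 • L (EuclideanSpace.single 2 (1 : ℝ)) := by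
    conv_lhs => rw [eq_sum_single v]
    simp only [map_add, map_smul]
  rw [h ν, h b, h c]
  simp only [Fin.sum_univ_three, inner_eq_sum, cross_apply_zero, cross_apply_one, cross_apply_two,
    PiLp.add_apply, PiLp.smul_apply, smul_eq_mul]
  ring

/-! ### The area formula -/

/-- The standard basis vectors of the parameter plane. -/
noncomputable def e2 (i : Fin 2) : E2 := EuclideanSpace.single i 1

/-- The Gram determinant of the two columns of `A` is the right-hand side of Lagrange's identity
`norm_cross_sq`. -/
theorem normDet_eq_norm_cross (A : E2 →L[ℝ] E3) :
    (A : E2 →ₗ[ℝ] E3).normDet = ‖cross (A (e2 0)) (A (e2 1))‖ := by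
  have h := (A : E2 →ₗ[ℝ] E3).normDet_sq_eq_det_gram (EuclideanSpace.basisFun (Fin 2) ℝ)
  rw [← sq_eq_sq₀ (LinearMap.normDet_nonneg _) (norm_nonneg _), norm_cross_sq]
  rw [RCLike.ofReal_real_eq_id, id] at h
  rw [h, Matrix.det_fin_two]
  simp only [Matrix.gram_apply, EuclideanSpace.basisFun_apply, e2, ContinuousLinearMap.coe_coe,
    ← real_inner_self_eq_norm_sq]
  rw [real_inner_comm (A (EuclideanSpace.single 1 1)) (A (EuclideanSpace.single 0 1))]
  ring

theorem measure_linear_image (A : E2 →L[ℝ] E3) (s : Set E2) :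
    μHE[2] (A '' s) = ENNReal.ofReal ‖cross (A (e2 0)) (A (e2 1))‖ * volume s := by
  have := (A : E2 →ₗ[ℝ] E3).euclideanHausdorffMeasure_image_eq_normDet_mul_volume s
  rw [normDet_eq_norm_cross, finrank_euclideanSpace_fin] at this
  exact this

/-- A map that contracts distances compared with another one has images of smaller area. -/
theorem euclideanHausdorffMeasure_image_le_of_edist_le {X Y Z : Type*} [MetricSpace Y]
    [MeasurableSpace Y] [BorelSpace Y] [MetricSpace Z] [MeasurableSpace Z] [BorelSpace Z]
    [Nonempty X] {f : X → Y} {g : X → Z} {s : Set X} {K : NNReal}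
    (h : ∀ x ∈ s, ∀ y ∈ s, dist (f x) (f y) ≤ K * dist (g x) (g y)) :
    μHE[2] (f '' s) ≤ (K : ENNReal) ^ 2 * μHE[2] (g '' s) := by
  have hinv : ∀ z ∈ g '' s, Function.invFunOn g s z ∈ s ∧ g (Function.invFunOn g s z) = z :=
    fun z hz => ⟨Function.invFunOn_mem hz, Function.invFunOn_eq hz⟩
  have hL : LipschitzOnWith K (f ∘ Function.invFunOn g s) (g '' s) := by
    refine LipschitzOnWith.of_dist_le_mul fun z hz w hw => ?_
    have := h _ (hinv z hz).1 _ (hinv w hw).1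
    rwa [(hinv z hz).2, (hinv w hw).2] at this
  -- `g` need not be injective on `s`; by `h`, points with the same value of `g` have the same value
  -- of `f`.
  have himg : (f ∘ Function.invFunOn g s) '' (g '' s) = f '' s := by
    rw [Set.image_image]
    refine Set.image_congr fun x hx => ?_
    have hx' := hinv (g x) (Set.mem_image_of_mem g hx)
    have := h _ hx'.1 x hx
    rw [hx'.2, dist_self, mul_zero] at this
    exact dist_le_zero.1 this
  have := hL.hausdorffMeasure_image_le (d := ((2 : ℕ) : ℝ)) (by norm_num)
  rw [himg, ENNReal.rpow_natCast] at this
  simp only [Measure.euclideanHausdorffMeasure_def, Measure.smul_apply, ENNReal.smul_def,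
    smul_eq_mul]
  calc _ ≤ _ := mul_le_mul_right this _
    _ = _ := by ring

/-- Comparison of measures from local comparison with an arbitrarily small error. -/
theorem restrict_le_restrict_of_locally_le_add {X : Type*} [TopologicalSpace X]
    [SecondCountableTopology X] [MeasurableSpace X] [BorelSpace X] {μ ν₁ ν₂ : Measure X}
    [SigmaFinite μ] {U : Set X} (hU : MeasurableSet U)
    (h : ∀ η : NNReal, 0 < η → ∀ u ∈ U, ∃ V ∈ 𝓝 u, ∀ S ⊆ V ∩ U, MeasurableSet S →
      ν₁ S ≤ ν₂ S + η * μ S) :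
    ν₁.restrict U ≤ ν₂.restrict U := by
  -- By the Lindelöf property countably many of the neighbourhoods suffice. Made disjoint, they have
  -- local errors that sum to `η * μ S`.
  have key : ∀ η : NNReal, 0 < η → ∀ S ⊆ U, MeasurableSet S → ν₁ S ≤ ν₂ S + η * μ S := by
    intro η hη S hSU hS
    choose! V hV hVS using h η hη
    obtain ⟨t, htU, htc, hcov⟩ := TopologicalSpace.countable_cover_nhdsWithin (s := U)
      (f := fun u => interior (V u)) fun u hu =>
        mem_nhdsWithin_of_mem_nhds (interior_mem_nhds.2 (hV u hu))
    rcases t.eq_empty_or_nonempty with rfl | hne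
    · have : S = ∅ := by
        simp only [Set.mem_empty_iff_false, Set.iUnion_of_empty, Set.iUnion_empty] at hcov
        exact Set.subset_empty_iff.1 (hSU.trans hcov)
      simp [this]
    obtain ⟨u, rfl⟩ := htc.exists_eq_range hne
    have hcov' : S ⊆ ⋃ n, interior (V (u n)) := by
      intro x hx
      have := hcov (hSU hx)
      simpa using this
    set D : ℕ → Set X := disjointed fun n => interior (V (u n)) with hD
    have hDm : ∀ n, MeasurableSet (D n) :=
      fun n => MeasurableSet.disjointed (fun n => isOpen_interior.measurableSet) n
    have hDd : Pairwise (Function.onFun Disjoint fun n => S ∩ D n) := fun i j hij =>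
      ((disjoint_disjointed _ hij).mono Set.inter_subset_right Set.inter_subset_right)
    have hSD : S = ⋃ n, S ∩ D n := by
      rw [← Set.inter_iUnion, hD, iUnion_disjointed]
      exact (Set.inter_eq_left.2 hcov').symm
    have hsum (ρ : Measure X) : ρ S = ∑' n, ρ (S ∩ D n) := by
      conv_lhs => rw [hSD]
      exact measure_iUnion hDd fun n => hS.inter (hDm n)
    rw [hsum ν₁, hsum ν₂, hsum μ, ← ENNReal.tsum_mul_left, ← ENNReal.tsum_add]
    refine ENNReal.tsum_le_tsum fun n => hVS (u n) (htU ⟨n, rfl⟩) _ ?_ (hS.inter (hDm n))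
    exact fun x hx => ⟨interior_subset (disjointed_subset _ n hx.2), hSU hx.1⟩
  -- The error `η * μ S` tends to zero with `η` only when `μ S` is finite; the spanning sets of `μ`
  -- then exhaust the general case.
  have key2 : ∀ S ⊆ U, MeasurableSet S → μ S < ⊤ → ν₁ S ≤ ν₂ S := by
    intro S hSU hS hfin
    refine ENNReal.le_of_forall_pos_le_add fun ε hε _ => ?_
    have hη : 0 < ε / ((μ S).toNNReal + 1) := by positivity
    refine (key _ hη S hSU hS).trans (add_le_add_right ?_ _)
    rw [← ENNReal.coe_toNNReal hfin.ne]
    norm_cast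
    rw [div_mul_eq_mul_div, div_le_iff₀ (by positivity)]
    exact mul_le_mul_right (by simp) _
  rw [Measure.le_iff]
  intro S hS
  rw [Measure.restrict_apply hS, Measure.restrict_apply hS]
  have hm : Monotone fun n => S ∩ U ∩ spanningSets μ n :=
    fun i j hij => Set.inter_subset_inter_right _ (monotone_spanningSets μ hij)
  have hun : S ∩ U = ⋃ n, S ∩ U ∩ spanningSets μ n := by
    rw [← Set.inter_iUnion, iUnion_spanningSets, Set.inter_univ]
  rw [hun, hm.measure_iUnion, hm.measure_iUnion]
  refine iSup_mono fun n => key2 _ (fun x hx => hx.1.2)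
    ((hS.inter hU).inter (measurableSet_spanningSets μ n)) ?_
  exact (measure_mono Set.inter_subset_right).trans_lt (measure_spanningSets_lt_top μ n)

/-- The area density of a parametrization. -/
noncomputable def jac (φ : E2 → E3) (u : E2) : NNReal :=
  ‖cross (fderiv ℝ φ u (e2 0)) (fderiv ℝ φ u (e2 1))‖₊

theorem continuous_cross : Continuous fun p : E3 × E3 => cross p.1 p.2 := by
  unfold cross
  simp only [cross_apply]
  fun_prop

theorem injective_of_cross_ne_zero {A : E2 →L[ℝ] E3} (h : cross (A (e2 0)) (A (e2 1)) ≠ 0) :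
    Function.Injective A := by
  have : (A : E2 →ₗ[ℝ] E3).normDet ≠ 0 := by rw [normDet_eq_norm_cross]; simpa using h
  exact ((A : E2 →ₗ[ℝ] E3).normDet_ne_zero_tfae.out 0 4).1 this

theorem continuousOn_jac {φ : E2 → E3} {U : Set E2} (hU : IsOpen U) (hφ : ContDiffOn ℝ 1 φ U) :
    ContinuousOn (jac φ) U := by
  have h := hφ.continuousOn_fderiv_of_isOpen hU le_rfl
  have h0 : ContinuousOn (fun u => fderiv ℝ φ u (e2 0)) U := h.clm_apply continuousOn_const
  have h1 : ContinuousOn (fun u => fderiv ℝ φ u (e2 1)) U := h.clm_apply continuousOn_const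
  exact (continuous_cross.comp_continuousOn (h0.prodMk h1)).nnnorm

/-- Near a point, areas of images are comparable with areas of images under the differential. -/
theorem exists_nhds_image_compare {φ : E2 → E3} {A : E2 →L[ℝ] E3} {u : E2}
    (hφ : HasStrictFDerivAt φ A u) (hA : Function.Injective A) {K : NNReal} (hK : 1 < K) :
    ∃ V ∈ 𝓝 u, ∀ x ∈ V, ∀ y ∈ V, dist (φ x) (φ y) ≤ K * dist (A x) (A y) ∧
      dist (A x) (A y) ≤ K * dist (φ x) (φ y) := by
  obtain ⟨c, hc0, hc⟩ := (A : E2 →ₗ[ℝ] E3).exists_antilipschitzWith (LinearMap.ker_eq_bot.2 hA)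
  have hKr : (1 : ℝ) < K := by exact_mod_cast hK
  have hKpos : (0 : ℝ) < K := by linarith
  have hcr : (0 : ℝ) < c := by exact_mod_cast hc0
  -- With this value `1 - θ = 1 / K` and `1 + θ ≤ K`, so a relative linearization error `θ` gives
  -- both inequalities with the same `K`.
  set θ : ℝ := (K - 1) / K with hθ
  have hθ0 : 0 < θ := div_pos (by linarith) hKpos
  have hε : 0 < θ / c := div_pos hθ0 hcr
  obtain ⟨V, hV, hVa⟩ := hφ.approximates_deriv_on_nhds (c := (θ / c).toNNReal)
    (Or.inr (Real.toNNReal_pos.2 hε))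
  refine ⟨V, hV, fun x hx y hy => ?_⟩
  have h1 := hVa x hx y hy
  rw [Real.coe_toNNReal _ hε.le] at h1
  have h2 : ‖x - y‖ ≤ c * ‖A (x - y)‖ := by
    have := hc.le_mul_dist x y
    rwa [dist_eq_norm, dist_eq_norm, ContinuousLinearMap.coe_coe, ← map_sub] at this
  have h3 : ‖φ x - φ y - A (x - y)‖ ≤ θ * ‖A (x - y)‖ := by
    refine h1.trans ((mul_le_mul_of_nonneg_left h2 hε.le).trans_eq ?_)
    field_simp
  rw [dist_eq_norm, dist_eq_norm, ← map_sub]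
  have h4 := norm_sub_norm_le (φ x - φ y) (A (x - y))
  have h5 := norm_sub_norm_le (A (x - y)) (φ x - φ y)
  rw [norm_sub_rev (A (x - y))] at h5
  have hθK : K * θ = K - 1 := by rw [hθ]; field_simp
  have hθ1 : θ ≤ K - 1 := by nlinarith
  constructor
  · nlinarith [norm_nonneg (A (x - y))]
  · nlinarith [norm_nonneg (A (x - y))]

/-- **Area formula** for an immersion of an open subset of the plane in three-space. -/
theorem area_formula {φ : E2 → E3} {U : Set E2} (hU : IsOpen U) (hφ : ContDiffOn ℝ 1 φ U)
    (hD : ∀ u ∈ U, cross (fderiv ℝ φ u (e2 0)) (fderiv ℝ φ u (e2 1)) ≠ 0) {ν : Measure E2}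
    (hν : ∀ S ⊆ U, MeasurableSet S → ν S = μHE[2] (φ '' S)) :
    ν.restrict U = (volume.restrict U).withDensity fun u => (jac φ u : ENNReal) := by
  have hJ := continuousOn_jac hU hφ
  have main : ∀ η : NNReal, 0 < η → ∀ u ∈ U, ∃ V ∈ 𝓝 u, ∀ S ⊆ V ∩ U, MeasurableSet S →
      ν S ≤ (∫⁻ u in S, jac φ u) + η * volume S ∧
      (∫⁻ u in S, jac φ u) ≤ ν S + η * volume S := by
    intro η hη u hu
    set J := jac φ u with hJu
    -- A single condition for both bounds. It gives `K² J ≤ J + η/2`, for the upper bound of `ν S`,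
    -- and `(K² - 1) K² J ≤ η/2`, for the cost of replacing `K² ν S` by `ν S`.
    obtain ⟨K, hK1, hK⟩ : ∃ K : NNReal, 1 < K ∧ K ^ 2 * (K ^ 2 * J) < K ^ 2 * J + η / 2 := by
      have hlim : Tendsto (fun K : NNReal => K ^ 2 * (K ^ 2 * J)) (𝓝[>] 1) (𝓝 J) := by
        have : Continuous fun K : NNReal => K ^ 2 * (K ^ 2 * J) := by fun_prop
        simpa using (this.tendsto 1).mono_left nhdsWithin_le_nhds
      have hlt : J < J + η / 2 := lt_add_of_pos_right _ (by positivity)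
      obtain ⟨K, h1, h2⟩ := ((hlim.eventually_lt_const hlt).and self_mem_nhdsWithin).exists
      have h2' : (1 : NNReal) ≤ K ^ 2 := one_le_pow₀ (le_of_lt h2)
      exact ⟨K, h2, h1.trans_le (add_le_add_left (le_mul_of_one_le_left' h2') _)⟩
    have hK2 : (1 : NNReal) ≤ K ^ 2 := one_le_pow₀ hK1.le
    have hKJ : K ^ 2 * J ≤ J + η / 2 := by
      have h : K ^ 2 * J + K ^ 2 * (K ^ 2 * J) ≤ K ^ 2 * (K ^ 2 * J) + (J + η / 2) := by
        have h1 : K ^ 2 * (K ^ 2 * J) ≤ K ^ 2 * J + η / 2 := hK.le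
        have hr1 : (K : ℝ) ^ 2 * (K ^ 2 * J) ≤ K ^ 2 * J + η / 2 := by exact_mod_cast h1
        have hr2 : (1 : ℝ) ≤ K ^ 2 := by exact_mod_cast hK2
        have : (K : ℝ) ^ 2 * J ≤ J + η / 2 := by
          nlinarith [mul_nonneg (mul_nonneg (sub_nonneg.2 hr2) (sub_nonneg.2 hr2)) J.coe_nonneg]
        have h3 : K ^ 2 * J ≤ J + η / 2 := by exact_mod_cast this
        rw [add_comm]; gcongr
      rw [add_comm] at h
      exact le_of_add_le_add_left h
    have hstrict : HasStrictFDerivAt φ (fderiv ℝ φ u) u :=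
      (hφ.contDiffAt (hU.mem_nhds hu)).hasStrictFDerivAt one_ne_zero
    obtain ⟨V, hV, hVK⟩ := exists_nhds_image_compare hstrict
      (injective_of_cross_ne_zero (hD u hu)) hK1
    have hJu' : ∀ᶠ v in 𝓝 u, jac φ v < J + η / 2 ∧ J < jac φ v + η / 2 := by
      have hc : Tendsto (jac φ) (𝓝 u) (𝓝 J) := (hJ.continuousAt (hU.mem_nhds hu))
      have hlt : J < J + η / 2 := lt_add_of_pos_right _ (by positivity)
      exact (hc.eventually_lt_const hlt).and ((hc.add_const _).eventually_const_lt hlt)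
    refine ⟨V ∩ {v | jac φ v < J + η / 2 ∧ J < jac φ v + η / 2}, inter_mem hV hJu',
      fun S hS hSm => ?_⟩
    have hA : μHE[2] (fderiv ℝ φ u '' S) = J * volume S := by
      rw [measure_linear_image, ofReal_norm]; rfl
    have hle1 : ν S ≤ (K : ENNReal) ^ 2 * (J * volume S) := by
      rw [hν S (fun x hx => (hS hx).2) hSm, ← hA]
      exact euclideanHausdorffMeasure_image_le_of_edist_le fun x hx y hy =>
        (hVK x (hS hx).1.1 y (hS hy).1.1).1
    have hle2 : J * volume S ≤ (K : ENNReal) ^ 2 * ν S := by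
      rw [hν S (fun x hx => (hS hx).2) hSm, ← hA]
      exact euclideanHausdorffMeasure_image_le_of_edist_le fun x hx y hy =>
        (hVK x (hS hx).1.1 y (hS hy).1.1).2
    have hI1 : (∫⁻ u in S, jac φ u) ≤ (J + η / 2 : NNReal) * volume S := by
      rw [← setLIntegral_const]
      exact setLIntegral_mono measurable_const fun x hx => by
        exact_mod_cast (hS hx).1.2.1.le
    have hI2 : J * volume S ≤ (∫⁻ u in S, jac φ u) + (η / 2 : NNReal) * volume S := by
      rw [← setLIntegral_const, ← setLIntegral_const, ← lintegral_add_right _ measurable_const]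
      refine setLIntegral_mono' hSm fun x hx => ?_
      exact_mod_cast (hS hx).1.2.2.le
    have hηη : ((η / 2 : NNReal) : ENNReal) + (η / 2 : NNReal) = η := by
      norm_cast; exact add_halves η
    constructor
    · calc ν S ≤ (K ^ 2 * J : NNReal) * volume S := by
            refine hle1.trans_eq ?_; push_cast; ring
        _ ≤ (J + η / 2 : NNReal) * volume S := by gcongr
        _ = J * volume S + (η / 2 : NNReal) * volume S := by
            rw [ENNReal.coe_add, add_mul]
        _ ≤ (∫⁻ u in S, jac φ u) + (η / 2 : NNReal) * volume S + (η / 2 : NNReal) * volume S := by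
            gcongr
        _ = _ := by rw [add_assoc, ← add_mul, hηη]
    · have hνlt : (K : ENNReal) ^ 2 * ν S ≤ ν S + (η / 2 : NNReal) * volume S := by
        obtain ⟨L, hL⟩ := exists_add_of_le hK2
        have hL2 : L * (K ^ 2 * J) ≤ η / 2 := by
          have : K ^ 2 * (K ^ 2 * J) ≤ K ^ 2 * J + η / 2 := hK.le
          nth_rw 1 [hL] at this
          rw [add_mul, one_mul] at this
          exact le_of_add_le_add_left this
        have hK' : (K : ENNReal) ^ 2 = 1 + L := by exact_mod_cast hL
        calc (K : ENNReal) ^ 2 * ν S = ν S + L * ν S := by rw [hK', add_mul, one_mul]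
          _ ≤ ν S + L * ((K : ENNReal) ^ 2 * (J * volume S)) := by gcongr
          _ = ν S + (L * (K ^ 2 * J) : NNReal) * volume S := by push_cast; ring
          _ ≤ _ := by gcongr
      calc (∫⁻ u in S, jac φ u) ≤ (J + η / 2 : NNReal) * volume S := hI1
        _ = J * volume S + (η / 2 : NNReal) * volume S := by
            rw [ENNReal.coe_add, add_mul]
        _ ≤ ν S + (η / 2 : NNReal) * volume S + (η / 2 : NNReal) * volume S := by
            gcongr; exact hle2.trans hνlt
        _ = _ := by rw [add_assoc, ← add_mul, hηη]
  rw [← restrict_withDensity hU.measurableSet]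
  refine le_antisymm
    (restrict_le_restrict_of_locally_le_add (μ := volume) hU.measurableSet fun η hη u hu => ?_)
    (restrict_le_restrict_of_locally_le_add (μ := volume) hU.measurableSet fun η hη u hu => ?_)
  · obtain ⟨V, hV, h⟩ := main η hη u hu
    exact ⟨V, hV, fun S hS hSm => by rw [withDensity_apply _ hSm]; exact (h S hS hSm).1⟩
  · obtain ⟨V, hV, h⟩ := main η hη u hu
    exact ⟨V, hV, fun S hS hSm => by rw [withDensity_apply _ hSm]; exact (h S hS hSm).2⟩

/-! ### Charts of a closed `C²` surface -/

/-- A parametrization `φ` of a relatively open piece `Γ ∩ source` of `Γ`, with smooth inverse `ψ`,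
and a defining function `f` of this piece. -/
structure SurfaceChart (Γ : Set E3) where
  source : Set E3
  dom : Set E2
  φ : E2 → E3
  ψ : E3 → E2
  f : E3 → ℝ
  isOpen_source : IsOpen source
  isOpen_dom : IsOpen dom
  contDiffOn_φ : ContDiffOn ℝ 2 φ dom
  contDiffOn_ψ : ContDiffOn ℝ 2 ψ source
  contDiffOn_f : ContDiffOn ℝ 2 f source
  φ_mem : ∀ u ∈ dom, φ u ∈ Γ ∩ source
  ψ_mem : ∀ y ∈ Γ ∩ source, ψ y ∈ dom
  φ_ψ : ∀ y ∈ Γ ∩ source, φ (ψ y) = y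
  ψ_φ : ∀ u ∈ dom, ψ (φ u) = u
  f_eq_zero : ∀ y ∈ Γ ∩ source, f y = 0
  fderiv_f_ne_zero : ∀ y ∈ source, fderiv ℝ f y ≠ 0

/-- The inclusion of the parameter plane as the plane `z₃ = 0`. -/
noncomputable def planeIncl : E2 →L[ℝ] E3 :=
  LinearMap.toContinuousLinearMap
    { toFun := fun u => WithLp.toLp 2 ![u 0, u 1, 0]
      map_add' := fun u v => by ext i; fin_cases i <;> simp
      map_smul' := fun c u => by ext i; fin_cases i <;> simp }

/-- The projection onto the first two coordinates. -/
noncomputable def planeProj : E3 →L[ℝ] E2 :=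
  LinearMap.toContinuousLinearMap
    { toFun := fun y => WithLp.toLp 2 ![y 0, y 1]
      map_add' := fun u v => by ext i; fin_cases i <;> simp
      map_smul' := fun c u => by ext i; fin_cases i <;> simp }

theorem planeProj_planeIncl (u : E2) : planeProj (planeIncl u) = u := by
  ext i; fin_cases i <;> simp [planeProj, planeIncl]

theorem planeIncl_apply_two (u : E2) : planeIncl u 2 = 0 := by
  simp [planeIncl]

theorem planeIncl_planeProj {y : E3} (hy : y 2 = 0) : planeIncl (planeProj y) = y := by
  refine ext_three ?_ ?_ ?_ <;> simp [planeProj, planeIncl, hy]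

/-- The slice `z₃ = 0` of a flattening diffeomorphism gives the parametrization and its inverse; the
third component is the defining function. -/
theorem IsClosedC2Surface.exists_chart {Γ : Set E3} (hΓ : IsClosedC2Surface Γ) {p : E3}
    (hp : p ∈ Γ) : ∃ c : SurfaceChart Γ, p ∈ c.source := by
  obtain ⟨Φ, hpΦ, hΦ, hΦs, hflat⟩ := hΓ.flatten p hp
  have hf2 : ContDiffOn ℝ 2 (fun y => Φ y 2) Φ.source :=
    (EuclideanSpace.proj (𝕜 := ℝ) (2 : Fin 3)).contDiff.comp_contDiffOn hΦ
  refine ⟨{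
    source := Φ.source
    dom := planeIncl ⁻¹' Φ.target
    φ := fun u => Φ.symm (planeIncl u)
    ψ := fun y => planeProj (Φ y)
    f := fun y => Φ y 2
    isOpen_source := Φ.open_source
    isOpen_dom := Φ.open_target.preimage planeIncl.continuous
    contDiffOn_φ := hΦs.comp planeIncl.contDiff.contDiffOn fun u hu => hu
    contDiffOn_ψ := planeProj.contDiff.comp_contDiffOn hΦ
    contDiffOn_f := hf2
    φ_mem := fun u hu => ?_
    ψ_mem := fun y hy => ?_
    φ_ψ := fun y hy => ?_
    ψ_φ := fun u hu => ?_
    f_eq_zero := fun y hy => (hflat y hy.2).1 hy.1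
    fderiv_f_ne_zero := fun y hy h0 => ?_ }, hpΦ⟩
  · have hs := Φ.map_target hu
    refine ⟨(hflat _ hs).2 ?_, hs⟩
    rw [Φ.right_inv hu, planeIncl_apply_two]
  · show planeIncl (planeProj (Φ y)) ∈ Φ.target
    rw [planeIncl_planeProj ((hflat y hy.2).1 hy.1)]
    exact Φ.map_source hy.2
  · show Φ.symm (planeIncl (planeProj (Φ y))) = y
    rw [planeIncl_planeProj ((hflat y hy.2).1 hy.1), Φ.left_inv hy.2]
  · show planeProj (Φ (Φ.symm (planeIncl u))) = u
    rw [Φ.right_inv hu, planeProj_planeIncl]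
  -- If the third component of `Φ` had zero derivative at `y`, so would its composite with `Φ.symm`
  -- at `Φ y`. That composite is the third coordinate function.
  · have hz := Φ.map_source hy
    have h1 : HasFDerivAt Φ.symm (fderiv ℝ Φ.symm (Φ y)) (Φ y) :=
      ((hΦs.contDiffAt (Φ.open_target.mem_nhds hz)).differentiableAt two_ne_zero).hasFDerivAt
    have h2 : HasFDerivAt (fun y => Φ y 2) (0 : E3 →L[ℝ] ℝ) (Φ.symm (Φ y)) := by
      rw [Φ.left_inv hy, ← h0]
      exact ((hf2.contDiffAt (Φ.open_source.mem_nhds hy)).differentiableAt two_ne_zero).hasFDerivAt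
    have h3 := h2.comp (Φ y) h1
    have h4 : HasFDerivAt ((fun y => Φ y 2) ∘ Φ.symm) (EuclideanSpace.proj (𝕜 := ℝ) (2 : Fin 3))
        (Φ y) := by
      refine (EuclideanSpace.proj (𝕜 := ℝ) (2 : Fin 3)).hasFDerivAt.congr_of_eventuallyEq ?_
      filter_upwards [Φ.open_target.mem_nhds hz] with z hz'
      simp [Φ.right_inv hz']
    have h5 := congrArg (fun A : E3 →L[ℝ] ℝ => A (EuclideanSpace.single 2 1)) (h3.unique h4)
    simp at h5

namespace SurfaceChart

variable {Γ : Set E3} (c : SurfaceChart Γ)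

/-- The gradient of the defining function, a normal field. -/
noncomputable def grad (y : E3) : E3 := (InnerProductSpace.toDual ℝ E3).symm (fderiv ℝ c.f y)

theorem inner_grad (y v : E3) : inner ℝ (c.grad y) v = fderiv ℝ c.f y v := by
  rw [grad, InnerProductSpace.toDual_symm_apply]

theorem grad_ne_zero {y : E3} (hy : y ∈ c.source) : c.grad y ≠ 0 := by
  simpa [grad] using c.fderiv_f_ne_zero y hy

theorem contDiffOn_grad : ContDiffOn ℝ 1 c.grad c.source :=
  (InnerProductSpace.toDual ℝ E3).symm.contDiff.comp_contDiffOn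
    (c.contDiffOn_f.fderiv_of_isOpen c.isOpen_source (by norm_num))

/-- The coordinate tangent vectors. -/
noncomputable def dφ (i : Fin 2) (u : E2) : E3 := fderiv ℝ c.φ u (e2 i)

theorem hasFDerivAt_φ {u : E2} (hu : u ∈ c.dom) : HasFDerivAt c.φ (fderiv ℝ c.φ u) u :=
  ((c.contDiffOn_φ.contDiffAt (c.isOpen_dom.mem_nhds hu)).differentiableAt
    two_ne_zero).hasFDerivAt

theorem contDiffOn_fderiv_φ : ContDiffOn ℝ 1 (fderiv ℝ c.φ) c.dom :=
  c.contDiffOn_φ.fderiv_of_isOpen c.isOpen_dom (by norm_num)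

theorem contDiffOn_dφ (i : Fin 2) : ContDiffOn ℝ 1 (c.dφ i) c.dom :=
  c.contDiffOn_fderiv_φ.clm_apply contDiffOn_const

/-- Since `ψ ∘ φ` is the identity on the domain, the differential of `φ` is injective, and so its
area factor is nonzero. -/
theorem cross_dφ_ne_zero {u : E2} (hu : u ∈ c.dom) : cross (c.dφ 0 u) (c.dφ 1 u) ≠ 0 := by
  have hψ : HasFDerivAt c.ψ (fderiv ℝ c.ψ (c.φ u)) (c.φ u) :=
    ((c.contDiffOn_ψ.contDiffAt (c.isOpen_source.mem_nhds (c.φ_mem u hu).2)).differentiableAt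
      two_ne_zero).hasFDerivAt
  have hid : HasFDerivAt (c.ψ ∘ c.φ) (ContinuousLinearMap.id ℝ E2) u := by
    refine (hasFDerivAt_id u).congr_of_eventuallyEq ?_
    filter_upwards [c.isOpen_dom.mem_nhds hu] with v hv using c.ψ_φ v hv
  have h := (hψ.comp u (c.hasFDerivAt_φ hu)).unique hid
  have hinj : Function.Injective (fderiv ℝ c.φ u) := by
    intro v w hvw
    have hv := congrArg (fun A : E2 →L[ℝ] E2 => A v) h
    have hw := congrArg (fun A : E2 →L[ℝ] E2 => A w) h
    simp only [ContinuousLinearMap.comp_apply, ContinuousLinearMap.id_apply] at hv hw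
    rw [← hv, ← hw, hvw]
  have hd : (fderiv ℝ c.φ u : E2 →ₗ[ℝ] E3).normDet ≠ 0 :=
    ((fderiv ℝ c.φ u : E2 →ₗ[ℝ] E3).normDet_ne_zero_tfae.out 0 4).2 hinj
  rw [normDet_eq_norm_cross] at hd
  exact norm_ne_zero_iff.1 hd

theorem fderiv_φ_mem_tangentPlane {u : E2} (hu : u ∈ c.dom) (v : E2) :
    fderiv ℝ c.φ u v ∈ tangentPlane Γ (c.φ u) := by
  refine Submodule.subset_span ?_
  have h := (c.hasFDerivAt_φ hu).hasFDerivWithinAt (s := c.dom)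
  have hv : v ∈ tangentConeAt ℝ c.dom u := by
    rw [tangentConeAt_of_mem_nhds (c.isOpen_dom.mem_nhds hu)]; trivial
  exact tangentConeAt_mono (Set.image_subset_iff.2 fun w hw => (c.φ_mem w hw).1)
    (h.mapsTo_tangent_cone hv)

/-- As `f` vanishes on the surface, both `0` and its ambient differential are derivatives of `f`
along `Γ`. Such derivatives agree on the tangent cone, hence on its span. -/
theorem inner_grad_of_mem_tangentPlane {y v : E3} (hy : y ∈ Γ ∩ c.source)
    (hv : v ∈ tangentPlane Γ y) : inner ℝ (c.grad y) v = 0 := by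
  have h1 : HasFDerivWithinAt c.f (fderiv ℝ c.f y) Γ y :=
    ((c.contDiffOn_f.contDiffAt (c.isOpen_source.mem_nhds hy.2)).differentiableAt
      two_ne_zero).hasFDerivAt.hasFDerivWithinAt
  have h2 : HasFDerivWithinAt c.f (0 : E3 →L[ℝ] ℝ) Γ y := by
    refine (hasFDerivWithinAt_const (0 : ℝ) y Γ).congr_of_eventuallyEq ?_ (c.f_eq_zero y hy)
    filter_upwards [self_mem_nhdsWithin,
      mem_nhdsWithin_of_mem_nhds (c.isOpen_source.mem_nhds hy.2)] with z hz hz'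
    exact c.f_eq_zero z ⟨hz, hz'⟩
  rw [inner_grad]
  have := LinearMap.eqOn_span (f := (fderiv ℝ c.f y : E3 →ₗ[ℝ] ℝ)) (g := 0)
    (fun w hw => h1.unique_on h2 hw) hv
  exact this

end SurfaceChart

/-! ### Frames -/

section Frame

variable {Γ : Set E3} {τ : Fin 2 → E3 → E3}

theorem norm_normal (hτ : IsTangentFrame Γ τ) {y : E3} (hy : y ∈ Γ) : ‖normal τ y‖ = 1 :=
  norm_cross_of_orthonormal (t := fun i => τ i y) (hτ y hy).2

theorem SurfaceChart.exists_grad_eq_smul (c : SurfaceChart Γ) (hτ : IsTangentFrame Γ τ) {y : E3}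
    (hy : y ∈ Γ ∩ c.source) : ∃ a : ℝ, a ≠ 0 ∧ c.grad y = a • normal τ y := by
  have h := eq_add_add_of_orthonormal (hτ y hy.1).2 (c.grad y)
  have h0 (i : Fin 2) : inner ℝ (τ i y) (c.grad y) = 0 := by
    rw [real_inner_comm]
    exact c.inner_grad_of_mem_tangentPlane hy ((hτ y hy.1).1 i)
  rw [h0, h0, zero_smul, zero_smul, zero_add, zero_add] at h
  refine ⟨_, fun ha => c.grad_ne_zero hy.2 ?_, h⟩
  rw [h, ha, zero_smul]

/-- The defining function shows that the span of the tangent cone is at most a plane; the frame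
shows that it is a whole plane. -/
theorem mem_tangentPlane_iff (hΓ : IsClosedC2Surface Γ) (hτ : IsTangentFrame Γ τ) {y : E3}
    (hy : y ∈ Γ) {v : E3} : v ∈ tangentPlane Γ y ↔ inner ℝ (normal τ y) v = 0 := by
  constructor
  · intro hv
    obtain ⟨c, hc⟩ := hΓ.exists_chart hy
    obtain ⟨a, ha, hac⟩ := c.exists_grad_eq_smul hτ ⟨hy, hc⟩
    have := c.inner_grad_of_mem_tangentPlane ⟨hy, hc⟩ hv
    rw [hac, inner_smul_left] at this
    simpa [ha] using this
  · intro hv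
    have h := eq_add_add_of_orthonormal (hτ y hy).2 v
    have hv' : inner ℝ (cross (τ 0 y) (τ 1 y)) v = 0 := hv
    rw [hv', zero_smul, add_zero] at h
    rw [h]
    exact Submodule.add_mem _ (Submodule.smul_mem _ _ ((hτ y hy).1 0))
      (Submodule.smul_mem _ _ ((hτ y hy).1 1))

theorem starProjection_tangentPlane (hΓ : IsClosedC2Surface Γ) (hτ : IsTangentFrame Γ τ) {y : E3}
    (hy : y ∈ Γ) (v : E3) :
    (tangentPlane Γ y).starProjection v = v - inner ℝ (normal τ y) v • normal τ y := by
  refine Submodule.eq_starProjection_of_mem_of_inner_eq_zero ?_ fun w hw => ?_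
  · rw [mem_tangentPlane_iff hΓ hτ hy, inner_sub_right, inner_smul_right,
      real_inner_self_eq_norm_sq, norm_normal hτ hy]
    ring
  · rw [sub_sub_cancel, inner_smul_left, (mem_tangentPlane_iff hΓ hτ hy).1 hw, mul_zero]

theorem tangential_eq (hτ : IsTangentFrame Γ τ) {y : E3} (hy : y ∈ Γ) (a : E3) :
    tangential τ a y = a - inner ℝ (normal τ y) a • normal τ y := by
  rw [tangential, cross_cross_self, norm_normal hτ hy, one_pow, one_smul]

theorem tangential_mem_tangentPlane (hΓ : IsClosedC2Surface Γ) (hτ : IsTangentFrame Γ τ) {y : E3}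
    (hy : y ∈ Γ) (a : E3) : tangential τ a y ∈ tangentPlane Γ y := by
  rw [tangential_eq hτ hy, ← starProjection_tangentPlane hΓ hτ hy]
  exact Submodule.coe_mem _

/-- The normal part of `v` does not see the sign or length of the normal. The possibly discontinuous
`n` can thus be traded for the `C¹` field `grad`; all regularity of the kernels rests on this. -/
theorem SurfaceChart.inner_normal_smul_normal (c : SurfaceChart Γ) (hτ : IsTangentFrame Γ τ)
    {y : E3} (hy : y ∈ Γ ∩ c.source) (v : E3) :
    inner ℝ (normal τ y) v • normal τ y =
      (inner ℝ (c.grad y) v / ‖c.grad y‖ ^ 2) • c.grad y := by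
  obtain ⟨a, ha, h⟩ := c.exists_grad_eq_smul hτ hy
  rw [h, inner_smul_left, norm_smul, norm_normal hτ hy.1, smul_smul, Real.norm_eq_abs, mul_one,
    sq_abs]
  congr 1
  simp only [conj_trivial]
  field_simp

theorem SurfaceChart.contDiffOn_normal_part (c : SurfaceChart Γ) (v : E3) :
    ContDiffOn ℝ 1 (fun y => (inner ℝ (c.grad y) v / ‖c.grad y‖ ^ 2) • c.grad y) c.source := by
  have h := c.contDiffOn_grad
  refine ContDiffOn.smul (ContDiffOn.div (h.inner ℝ contDiffOn_const) (h.norm_sq ℝ) ?_) h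
  intro y hy
  simpa using c.grad_ne_zero hy

end Frame

/-! ### Surface differentials -/

section SurfDeriv

variable {F : Type*} [NormedAddCommGroup F] [NormedSpace ℝ F] {Γ : Set E3}

theorem surfDeriv_apply_of_mem {f : E3 → F} {y v : E3} (hv : v ∈ tangentPlane Γ y) :
    surfDeriv Γ f y v = fderivWithin ℝ f Γ y v := by
  rw [surfDeriv, ContinuousLinearMap.comp_apply, Submodule.starProjection_eq_self_iff.2 hv]

theorem fderivWithin_apply_of_mem {f : E3 → F} {y v : E3} {f' : E3 →L[ℝ] F}
    (hf : HasFDerivWithinAt f f' Γ y) (hv : v ∈ tangentPlane Γ y) :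
    fderivWithin ℝ f Γ y v = f' v :=
  LinearMap.eqOn_span (f := (fderivWithin ℝ f Γ y : E3 →ₗ[ℝ] F)) (g := (f' : E3 →ₗ[ℝ] F))
    (fun _ hw => hf.differentiableWithinAt.hasFDerivWithinAt.unique_on hf hw) hv

theorem surfDeriv_eq {f : E3 → F} {y : E3} {f' : E3 →L[ℝ] F} (hf : HasFDerivWithinAt f f' Γ y) :
    surfDeriv Γ f y = f'.comp (tangentPlane Γ y).starProjection := by
  ext v
  exact fderivWithin_apply_of_mem hf (Submodule.coe_mem _)

theorem surfDeriv_comp_starProjection {f : E3 → F} {y v : E3} :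
    surfDeriv Γ f y ((tangentPlane Γ y).starProjection v) = surfDeriv Γ f y v :=
  surfDeriv_apply_of_mem (Submodule.coe_mem _)

/-- Continuously differentiable along `Γ`. -/
def IsC1Along (Γ : Set E3) (f : E3 → F) : Prop :=
  (∀ y ∈ Γ, DifferentiableWithinAt ℝ f Γ y) ∧ ContinuousOn (surfDeriv Γ f) Γ

theorem IsC1Along.continuousOn {f : E3 → F} (hf : IsC1Along Γ f) : ContinuousOn f Γ :=
  fun y hy => (hf.1 y hy).continuousWithinAt

theorem surfDeriv_mul {f g : E3 → ℂ} {y : E3} (hf : DifferentiableWithinAt ℝ f Γ y)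
    (hg : DifferentiableWithinAt ℝ g Γ y) :
    surfDeriv Γ (fun z => f z * g z) y = f y • surfDeriv Γ g y + g y • surfDeriv Γ f y := by
  rw [surfDeriv_eq (hf.hasFDerivWithinAt.fun_mul hg.hasFDerivWithinAt)]
  rfl

theorem IsC1Along.mul {f g : E3 → ℂ} (hf : IsC1Along Γ f) (hg : IsC1Along Γ g) :
    IsC1Along Γ fun z => f z * g z := by
  refine ⟨fun y hy => (hf.1 y hy).mul (hg.1 y hy), ?_⟩
  have h : ContinuousOn (fun y => f y • surfDeriv Γ g y + g y • surfDeriv Γ f y) Γ :=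
    (hf.continuousOn.smul hg.2).add (hg.continuousOn.smul hf.2)
  exact h.congr fun y hy => surfDeriv_mul (hf.1 y hy) (hg.1 y hy)

variable {τ : Fin 2 → E3 → E3}

/-- The tangent plane depends continuously on the point, whatever the frame does, because its
projection can be written with `grad`. -/
theorem continuousOn_starProjection (hΓ : IsClosedC2Surface Γ) (hτ : IsTangentFrame Γ τ) :
    ContinuousOn (fun y => (tangentPlane Γ y).starProjection) Γ := by
  rw [continuousOn_clm_apply]
  intro v p hp
  obtain ⟨c, hc⟩ := hΓ.exists_chart hp
  have hcont : ContinuousWithinAt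
      (fun y => v - (inner ℝ (c.grad y) v / ‖c.grad y‖ ^ 2) • c.grad y) Γ p :=
    (continuousAt_const.sub ((c.contDiffOn_normal_part v).continuousOn.continuousAt
      (c.isOpen_source.mem_nhds hc))).continuousWithinAt
  refine hcont.congr_of_eventuallyEq ?_ ?_
  · filter_upwards [self_mem_nhdsWithin,
      mem_nhdsWithin_of_mem_nhds (c.isOpen_source.mem_nhds hc)] with y hy hy'
    rw [starProjection_tangentPlane hΓ hτ hy, c.inner_normal_smul_normal hτ ⟨hy, hy'⟩]
  · rw [starProjection_tangentPlane hΓ hτ hp, c.inner_normal_smul_normal hτ ⟨hp, hc⟩]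

/-- A map which is locally the restriction of a `C¹` map is continuously differentiable along the
surface. -/
theorem isC1Along_of_locally (hΓ : IsClosedC2Surface Γ) (hτ : IsTangentFrame Γ τ) {f : E3 → F}
    (h : ∀ p ∈ Γ, ∃ (W : Set E3) (g : E3 → F), IsOpen W ∧ p ∈ W ∧ ContDiffOn ℝ 1 g W ∧
      ∀ y ∈ Γ ∩ W, f y = g y) : IsC1Along Γ f := by
  have key : ∀ (W : Set E3) (g : E3 → F), IsOpen W → ContDiffOn ℝ 1 g W →
      (∀ y ∈ Γ ∩ W, f y = g y) → ∀ y ∈ Γ ∩ W, HasFDerivWithinAt f (fderiv ℝ g y) Γ y := by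
    intro W g hW hg hfg y hy
    have h1 : HasFDerivWithinAt g (fderiv ℝ g y) Γ y :=
      ((hg.contDiffAt (hW.mem_nhds hy.2)).differentiableAt
        one_ne_zero).hasFDerivAt.hasFDerivWithinAt
    refine h1.congr_of_eventuallyEq ?_ (hfg y hy)
    filter_upwards [self_mem_nhdsWithin, mem_nhdsWithin_of_mem_nhds (hW.mem_nhds hy.2)] with z h1 h2
    exact hfg z ⟨h1, h2⟩
  refine ⟨fun p hp => ?_, fun p hp => ?_⟩
  · obtain ⟨W, g, hW, hpW, hg, hfg⟩ := h p hp
    exact (key W g hW hg hfg p ⟨hp, hpW⟩).differentiableWithinAt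
  · obtain ⟨W, g, hW, hpW, hg, hfg⟩ := h p hp
    have h1 : ContinuousWithinAt
        (fun y => (fderiv ℝ g y).comp (tangentPlane Γ y).starProjection) Γ p :=
      (((hg.continuousOn_fderiv_of_isOpen hW le_rfl).continuousAt
        (hW.mem_nhds hpW)).continuousWithinAt).clm_comp (continuousOn_starProjection hΓ hτ p hp)
    refine h1.congr_of_eventuallyEq ?_ (surfDeriv_eq (key W g hW hg hfg p ⟨hp, hpW⟩))
    filter_upwards [self_mem_nhdsWithin, mem_nhdsWithin_of_mem_nhds (hW.mem_nhds hpW)] with z h1 h2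
    exact surfDeriv_eq (key W g hW hg hfg z ⟨h1, h2⟩)

theorem ContDiff.isC1Along (hΓ : IsClosedC2Surface Γ) (hτ : IsTangentFrame Γ τ) {f : E3 → F}
    (hf : ContDiff ℝ 1 f) : IsC1Along Γ f :=
  isC1Along_of_locally hΓ hτ fun _ _ =>
    ⟨Set.univ, f, isOpen_univ, trivial, hf.contDiffOn, fun _ _ => rfl⟩

theorem surfDeriv_apply_of_differentiableAt {f : E3 → F} {y v : E3} (hf : DifferentiableAt ℝ f y)
    (hv : v ∈ tangentPlane Γ y) : surfDeriv Γ f y v = fderiv ℝ f y v := by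
  rw [surfDeriv_apply_of_mem hv, fderivWithin_apply_of_mem hf.hasFDerivAt.hasFDerivWithinAt hv]

/-! ### Regularity of the tangential field and of the density -/

theorem isC1Along_tangential (hΓ : IsClosedC2Surface Γ) (hτ : IsTangentFrame Γ τ) (a : E3) :
    IsC1Along Γ (tangential τ a) := by
  refine isC1Along_of_locally hΓ hτ fun p hp => ?_
  obtain ⟨c, hc⟩ := hΓ.exists_chart hp
  refine ⟨c.source, fun y => a - (inner ℝ (c.grad y) a / ‖c.grad y‖ ^ 2) • c.grad y,
    c.isOpen_source, hc, contDiffOn_const.sub (c.contDiffOn_normal_part a), fun y hy => ?_⟩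
  rw [tangential_eq hτ hy.1, c.inner_normal_smul_normal hτ hy]

theorem IsC1Along.continuousOn_surfDiv {J : E3 → E3} (hJ : IsC1Along Γ J) :
    ContinuousOn (surfDiv Γ J) Γ := by
  refine continuousOn_finsetSum _ fun j _ => ?_
  exact (EuclideanSpace.proj (𝕜 := ℝ) j).continuous.comp_continuousOn
    (hJ.2.clm_apply continuousOn_const)

theorem tangential_eq_sum (a : E3) (y : E3) :
    tangential τ a y = ∑ k, a k • tangential τ (EuclideanSpace.single k 1) y := by
  simp only [tangential, cross_cross_self, Fin.sum_univ_three]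
  refine ext_three ?_ ?_ ?_ <;>
  · simp [inner_eq_sum]
    ring

theorem surfDiv_tangential_eq_sum (hΓ : IsClosedC2Surface Γ) (hτ : IsTangentFrame Γ τ) (a : E3)
    {y : E3} (hy : y ∈ Γ) : surfDiv Γ (tangential τ a) y =
      ∑ k, a k * surfDiv Γ (tangential τ (EuclideanSpace.single k 1)) y := by
  have h : HasFDerivWithinAt (tangential τ a) (∑ k, a k • fderivWithin ℝ
      (tangential τ (EuclideanSpace.single k 1)) Γ y) Γ y := by
    have := HasFDerivWithinAt.fun_sum (u := Finset.univ) fun k _ =>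
      (((isC1Along_tangential hΓ hτ (EuclideanSpace.single k 1)).1 y hy).hasFDerivWithinAt).const_smul
        (a k)
    exact this.congr (fun z _ => tangential_eq_sum a z) (tangential_eq_sum a y)
  simp only [surfDiv, surfDeriv_eq h, Finset.mul_sum]
  rw [Finset.sum_comm]
  simp [surfDeriv, Fin.sum_univ_three]

/-- The bound has to be uniform in `a`, which will be `τ i x` with `x` varying and no continuity of
`τ`. By linearity in `a` the three fields of the standard basis suffice. -/
theorem exists_abs_surfDiv_tangential_le (hΓ : IsClosedC2Surface Γ) (hτ : IsTangentFrame Γ τ) :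
    ∃ C : ℝ, ∀ y ∈ Γ, ∀ a : E3, ‖a‖ ≤ 1 → |surfDiv Γ (tangential τ a) y| ≤ C := by
  choose C hC using fun k : Fin 3 => hΓ.isCompact.exists_bound_of_continuousOn
    (isC1Along_tangential hΓ hτ (EuclideanSpace.single k 1)).continuousOn_surfDiv
  refine ⟨∑ k, C k, fun y hy a ha => ?_⟩
  rw [surfDiv_tangential_eq_sum hΓ hτ a hy]
  refine (Finset.abs_sum_le_sum_abs _ _).trans (Finset.sum_le_sum fun k _ => ?_)
  rw [abs_mul]
  have h1 : |a k| ≤ 1 := by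
    rw [← Real.norm_eq_abs]; exact (PiLp.norm_apply_le a k).trans ha
  have h2 := hC k y hy
  rw [Real.norm_eq_abs] at h2
  exact (mul_le_of_le_one_left (abs_nonneg _) h1).trans h2

theorem surfDeriv_apply_eq_cdot (σ : E3 → ℂ) (y v : E3) :
    surfDeriv Γ σ y v = cdot v (surfGrad Γ σ y) := by
  conv_lhs => rw [eq_sum_single v]
  simp [cdot, surfGrad, Fin.sum_univ_three]

/-- Hölder continuity enters the argument through continuity of the surface gradient alone. -/
theorem IsC1Holder.isC1Along {σ : E3 → ℂ} {α : ℝ} (hα : 0 < α) (hσ : IsC1Holder Γ α σ) :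
    IsC1Along Γ σ := by
  refine ⟨hσ.1, ?_⟩
  obtain ⟨C, hC⟩ := hσ.2
  have hgrad : ContinuousOn (surfGrad Γ σ) Γ := by
    intro y hy
    rw [ContinuousWithinAt, tendsto_iff_norm_sub_tendsto_zero]
    have hlim : Tendsto (fun z : E3 => C * ‖z - y‖ ^ α) (𝓝[Γ] y) (𝓝 0) := by
      have hcont : Continuous fun z : E3 => C * ‖z - y‖ ^ α :=
        continuous_const.mul ((continuous_id.sub continuous_const).norm.rpow_const
          fun _ => Or.inr hα.le)
      have := (hcont.tendsto y).mono_left (nhdsWithin_le_nhds (s := Γ))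
      simpa [Real.zero_rpow hα.ne'] using this
    refine squeeze_zero' (Eventually.of_forall fun _ => norm_nonneg _) ?_ hlim
    filter_upwards [self_mem_nhdsWithin] with z hz using hC z hz y hy
  rw [continuousOn_clm_apply]
  intro v
  simp only [surfDeriv_apply_eq_cdot, cdot]
  refine continuousOn_finsetSum _ fun j _ => continuousOn_const.mul ?_
  exact (EuclideanSpace.proj (𝕜 := ℂ) j).continuous.comp_continuousOn hgrad

/-! ### The normal component of chords -/

/-- The normal component of a chord is quadratically small, locally. -/
theorem SurfaceChart.exists_inner_normal_le (c : SurfaceChart Γ) (hτ : IsTangentFrame Γ τ) {p : E3}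
    (hp : p ∈ c.source) : ∃ C : ℝ, ∃ r > 0, ∀ x ∈ Γ ∩ Metric.ball p r, ∀ y ∈ Γ ∩ Metric.ball p r,
      |inner ℝ (normal τ y) (x - y)| ≤ C * ‖x - y‖ ^ 2 := by
  have hp' := c.isOpen_source.mem_nhds hp
  obtain ⟨K, V, hV, hK⟩ := (((c.contDiffOn_f.fderiv_of_isOpen c.isOpen_source
    (m := 1) (by norm_num)).contDiffAt hp')).exists_lipschitzOnWith
  have hpos : 0 < ‖c.grad p‖ := norm_pos_iff.2 (c.grad_ne_zero hp)
  have hlow : ∀ᶠ y in 𝓝 p, ‖c.grad p‖ / 2 < ‖c.grad y‖ :=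
    (c.contDiffOn_grad.continuousOn.continuousAt hp').norm.eventually_const_lt (half_lt_self hpos)
  obtain ⟨r, hr, hball⟩ := Metric.mem_nhds_iff.1 (inter_mem (inter_mem hV hlow) hp')
  refine ⟨K / (‖c.grad p‖ / 2), r, hr, fun x hx y hy => ?_⟩
  have hxs := (hball hx.2).2
  have hys := (hball hy.2).2
  have hkey : ‖c.f x - c.f y - fderiv ℝ c.f y (x - y)‖ ≤ K * ‖x - y‖ * ‖x - y‖ := by
    -- The segment may leave the surface, but it stays in a ball on which `f` is defined with
    -- Lipschitz derivative; there Taylor's estimate holds.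
    have hseg : segment ℝ y x ⊆ Metric.ball p r := (convex_ball p r).segment_subset hy.2 hx.2
    refine (convex_segment y x).norm_image_sub_le_of_norm_hasFDerivWithin_le'
      (f := c.f) (f' := fderiv ℝ c.f) (fun z hz => ?_) (fun z hz => ?_) (left_mem_segment ℝ y x)
      (right_mem_segment ℝ y x)
    · exact ((c.contDiffOn_f.contDiffAt (c.isOpen_source.mem_nhds
        (hball (hseg hz)).2)).differentiableAt two_ne_zero).hasFDerivAt.hasFDerivWithinAt
    · have h1 := hK.dist_le_mul z (hball (hseg hz)).1.1 y (hball hy.2).1.1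
      rw [dist_eq_norm, dist_eq_norm] at h1
      refine h1.trans (mul_le_mul_of_nonneg_left ?_ K.coe_nonneg)
      exact norm_sub_le_of_mem_segment hz
  rw [c.f_eq_zero x ⟨hx.1, hxs⟩, c.f_eq_zero y ⟨hy.1, hys⟩, sub_zero, zero_sub, norm_neg,
    ← c.inner_grad] at hkey
  obtain ⟨a, ha, hac⟩ := c.exists_grad_eq_smul hτ ⟨hy.1, hys⟩
  have hg : ‖c.grad y‖ = |a| := by rw [hac, norm_smul, norm_normal hτ hy.1, mul_one, Real.norm_eq_abs]
  have hy2 : ‖c.grad p‖ / 2 < |a| := hg ▸ (hball hy.2).1.2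
  rw [hac, inner_smul_left, norm_mul, conj_trivial, Real.norm_eq_abs, Real.norm_eq_abs] at hkey
  rw [div_mul_eq_mul_div, le_div_iff₀ (by positivity), mul_comm]
  calc _ ≤ |a| * |inner ℝ (normal τ y) (x - y)| := by gcongr
    _ ≤ _ := hkey.trans_eq (by ring)

theorem exists_inner_normal_le (hΓ : IsClosedC2Surface Γ) (hτ : IsTangentFrame Γ τ) :
    ∃ C : ℝ, 0 ≤ C ∧ ∀ x ∈ Γ, ∀ y ∈ Γ, |inner ℝ (normal τ y) (x - y)| ≤ C * ‖x - y‖ ^ 2 := by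
  have hloc : ∀ p : Γ, ∃ C : ℝ, ∃ r > 0, ∀ x ∈ Γ ∩ Metric.ball p.1 r, ∀ y ∈ Γ ∩ Metric.ball p.1 r,
      |inner ℝ (normal τ y) (x - y)| ≤ C * ‖x - y‖ ^ 2 := fun p => by
    obtain ⟨c, hc⟩ := hΓ.exists_chart p.2
    exact c.exists_inner_normal_le hτ hc
  choose C r hr hC using hloc
  obtain ⟨t, ht⟩ := hΓ.isCompact.elim_finite_subcover (fun p : Γ => Metric.ball p.1 (r p / 2))
    (fun p => Metric.isOpen_ball) fun p hp =>
      Set.mem_iUnion.2 ⟨⟨p, hp⟩, Metric.mem_ball_self (half_pos (hr _))⟩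
  -- The sum dominates every local constant. The terms `2 / r p` serve chords of length at least `r
  -- p / 2`, for which `|n · (x - y)| ≤ ‖x - y‖ ≤ (2 / r p) ‖x - y‖²`.
  refine ⟨∑ p ∈ t, (|C p| + 2 / r p), Finset.sum_nonneg fun p _ => by
    have := hr p; positivity, fun x hx y hy => ?_⟩
  obtain ⟨p, hpt, hyp⟩ := Set.mem_iUnion₂.1 (ht hy)
  have hle : |C p| + 2 / r p ≤ ∑ p ∈ t, (|C p| + 2 / r p) :=
    Finset.single_le_sum (f := fun p => |C p| + 2 / r p)
      (fun p _ => by have := hr p; positivity) hpt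
  refine le_trans ?_ (mul_le_mul_of_nonneg_right hle (sq_nonneg _))
  have hrp := hr p
  by_cases hxy : ‖x - y‖ < r p / 2
  · have hxb : x ∈ Metric.ball p.1 (r p) := by
      have h1 := Metric.mem_ball.1 hyp
      rw [Metric.mem_ball]
      have := dist_triangle x y p
      rw [dist_eq_norm x y] at this
      linarith
    have hyb : y ∈ Metric.ball p.1 (r p) := Metric.ball_subset_ball (by linarith) hyp
    refine (hC p x ⟨hx, hxb⟩ y ⟨hy, hyb⟩).trans (mul_le_mul_of_nonneg_right ?_ (sq_nonneg _))
    have : 0 < 2 / r p := by positivity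
    linarith [le_abs_self (C p)]
  · have h1 : |inner ℝ (normal τ y) (x - y)| ≤ ‖x - y‖ := by
      have := abs_real_inner_le_norm (normal τ y) (x - y)
      rwa [norm_normal hτ hy, one_mul] at this
    have h2 : 1 ≤ 2 / r p * ‖x - y‖ := by
      rw [div_mul_eq_mul_div, le_div_iff₀ hrp]; linarith
    nlinarith [norm_nonneg (x - y), mul_nonneg (abs_nonneg (C p)) (sq_nonneg ‖x - y‖)]

end SurfDeriv

/-! ### Surface area in charts -/

theorem IsClosedC2Surface.measurableSet {Γ : Set E3} (hΓ : IsClosedC2Surface Γ) :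
    MeasurableSet Γ := hΓ.isCompact.measurableSet

namespace SurfaceChart

variable {Γ : Set E3} (c : SurfaceChart Γ)

theorem aemeasurable_ψ (hΓ : MeasurableSet Γ) (μ : Measure E3) :
    AEMeasurable c.ψ (μ.restrict (Γ ∩ c.source)) :=
  (c.contDiffOn_ψ.continuousOn.mono Set.inter_subset_right).aemeasurable
    (hΓ.inter c.isOpen_source.measurableSet)

/-- For `S` in the domain, the preimage of `S` under `ψ` in the chart is `φ '' S`, so the area
formula identifies the push-forward. It has no mass outside the domain, where `ψ` takes no values.
-/
theorem map_ψ (hΓ : MeasurableSet Γ) :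
    (μHE[2].restrict (Γ ∩ c.source)).map c.ψ =
      (volume.restrict c.dom).withDensity fun u => (jac c.φ u : ENNReal) := by
  set ν := (μHE[2].restrict (Γ ∩ c.source)).map c.ψ with hν
  have hms : MeasurableSet (Γ ∩ c.source) := hΓ.inter c.isOpen_source.measurableSet
  have hνS (S : Set E2) (hS : MeasurableSet S) : ν S = μHE[2] (c.ψ ⁻¹' S ∩ (Γ ∩ c.source)) := by
    rw [hν, Measure.map_apply_of_aemeasurable (c.aemeasurable_ψ hΓ _) hS,
      Measure.restrict_apply' hms]
  have h := area_formula c.isOpen_dom (c.contDiffOn_φ.of_le one_le_two)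
    (fun u hu => c.cross_dφ_ne_zero hu) (ν := ν) fun S hSU hS => by
      rw [hνS S hS]
      congr 1
      ext y
      constructor
      · rintro ⟨h1, h2⟩
        exact ⟨c.ψ y, h1, c.φ_ψ y h2⟩
      · rintro ⟨u, hu, rfl⟩
        refine ⟨?_, c.φ_mem u (hSU hu)⟩
        rw [Set.mem_preimage, c.ψ_φ u (hSU hu)]
        exact hu
  rw [← h, eq_comm]
  refine Measure.restrict_eq_self_of_ae_mem ?_
  rw [ae_iff, ← Set.compl_def, hνS _ c.isOpen_dom.measurableSet.compl]
  convert measure_empty (μ := (μHE[2] : Measure E3))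
  ext y
  simp only [Set.mem_inter_iff, Set.mem_preimage, Set.mem_compl_iff, Set.mem_empty_iff_false,
    iff_false, not_and]
  exact fun h1 h2 h3 => h1 (c.ψ_mem y ⟨h2, h3⟩)

theorem continuousOn_jac : ContinuousOn (jac c.φ) c.dom :=
  LayerPotential.continuousOn_jac c.isOpen_dom (c.contDiffOn_φ.of_le one_le_two)

/-- Surface integrals in a chart. -/
theorem setIntegral_eq (hΓ : MeasurableSet Γ) {F : Type*} [NormedAddCommGroup F]
    [NormedSpace ℝ F] {f : E3 → F} (hf : ContinuousOn f (Γ ∩ c.source)) :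
    ∫ y in Γ ∩ c.source, f y ∂μHE[2] = ∫ u in c.dom, jac c.φ u • f (c.φ u) := by
  have hms : MeasurableSet (Γ ∩ c.source) := hΓ.inter c.isOpen_source.measurableSet
  have hφ : ContinuousOn (f ∘ c.φ) c.dom := hf.comp c.contDiffOn_φ.continuousOn c.φ_mem
  have h1 : ∫ y in Γ ∩ c.source, f y ∂μHE[2] =
      ∫ y in Γ ∩ c.source, (f ∘ c.φ) (c.ψ y) ∂μHE[2] :=
    setIntegral_congr_fun hms fun y hy => by
      simp only [Function.comp_apply, c.φ_ψ y hy]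
  have hJm : AEMeasurable (jac c.φ) (volume.restrict c.dom) :=
    c.continuousOn_jac.aemeasurable c.isOpen_dom.measurableSet
  rw [h1, ← integral_map (c.aemeasurable_ψ hΓ _), c.map_ψ hΓ,
    integral_withDensity_eq_integral_smul₀ hJm]
  · rfl
  · rw [c.map_ψ hΓ]
    exact (hφ.aestronglyMeasurable c.isOpen_dom.measurableSet).mono_ac
      (withDensity_absolutelyContinuous _ _)

/-- The area density is bounded on a compact part of the domain, so planar integrability passes to
the surface. -/
theorem integrableOn_comp_ψ (hΓ : MeasurableSet Γ) {g : E2 → ℝ} {B : Set E2}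
    (hB : MeasurableSet B) (hBc : IsCompact B) (hBU : B ⊆ c.dom) (hg : IntegrableOn g B) :
    IntegrableOn (fun y => g (c.ψ y)) (c.ψ ⁻¹' B ∩ (Γ ∩ c.source)) μHE[2] := by
  have hms : MeasurableSet (Γ ∩ c.source) := hΓ.inter c.isOpen_source.measurableSet
  obtain ⟨M, hM⟩ := hBc.exists_bound_of_continuousOn
    (NNReal.continuous_coe.comp_continuousOn (c.continuousOn_jac.mono hBU))
  have hJm : AEMeasurable (jac c.φ) (volume.restrict B) :=
    (c.continuousOn_jac.mono hBU).aemeasurable hB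
  have hν : IntegrableOn g B ((μHE[2].restrict (Γ ∩ c.source)).map c.ψ) := by
    rw [c.map_ψ hΓ, IntegrableOn, restrict_withDensity hB,
      Measure.restrict_restrict_of_subset hBU, integrable_withDensity_iff_integrable_smul₀ hJm]
    refine Integrable.mono' (hg.norm.const_mul M)
      (hJm.coe_nnreal_real.aestronglyMeasurable.smul hg.aestronglyMeasurable) ?_
    filter_upwards [ae_restrict_mem hB] with u hu
    have h1 := hM u hu
    rw [NNReal.smul_def, norm_smul]
    exact mul_le_mul_of_nonneg_right h1 (norm_nonneg _)
  have hψ := c.aemeasurable_ψ hΓ μHE[2]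
  have h3 : Integrable (B.indicator g) ((μHE[2].restrict (Γ ∩ c.source)).map c.ψ) :=
    (integrable_indicator_iff hB).2 hν
  have h4 := h3.comp_aemeasurable hψ
  have h5 := h4.integrableOn (s := c.ψ ⁻¹' B)
  have hnull : NullMeasurableSet (c.ψ ⁻¹' B) (μHE[2].restrict (Γ ∩ c.source)) :=
    hψ.nullMeasurable hB
  rw [IntegrableOn, Measure.restrict_restrict₀ hnull] at h5
  have hsub : NullMeasurableSet (c.ψ ⁻¹' B ∩ (Γ ∩ c.source)) μHE[2] := by
    have h6 := (nullMeasurableSet_restrict hms.nullMeasurableSet).1 hnull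
    exact h6
  refine h5.congr ?_
  filter_upwards [ae_restrict_mem₀ hsub] with y hy
  exact Set.indicator_of_mem (show c.ψ y ∈ B from hy.1) g

theorem exists_closedBall_subset_dom {p : E3} (hp : p ∈ Γ ∩ c.source) :
    ∃ r > 0, Metric.closedBall (c.ψ p) r ⊆ c.dom :=
  Metric.nhds_basis_closedBall.mem_iff.1 (c.isOpen_dom.mem_nhds (c.ψ_mem p hp))

theorem preimage_closedBall_mem_nhds {p : E3} (hp : p ∈ Γ ∩ c.source) {r : ℝ} (hr : 0 < r) :
    c.ψ ⁻¹' Metric.closedBall (c.ψ p) r ∩ c.source ∈ 𝓝 p :=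
  inter_mem ((c.contDiffOn_ψ.continuousOn.continuousAt (c.isOpen_source.mem_nhds hp.2))
    (Metric.closedBall_mem_nhds _ hr)) (c.isOpen_source.mem_nhds hp.2)

end SurfaceChart

/-! ### Finiteness of area and integrability of the weak singularity -/

variable {Γ : Set E3}

theorem IsClosedC2Surface.area_lt_top (hΓ : IsClosedC2Surface Γ) : μHE[2] Γ < ⊤ := by
  refine hΓ.isCompact.measure_lt_top_of_nhdsWithin fun p hp => ?_
  obtain ⟨c, hc⟩ := hΓ.exists_chart hp
  obtain ⟨r, hr, hrU⟩ := c.exists_closedBall_subset_dom ⟨hp, hc⟩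
  refine ⟨c.ψ ⁻¹' Metric.closedBall (c.ψ p) r ∩ (Γ ∩ c.source), ?_, ?_⟩
  · filter_upwards [self_mem_nhdsWithin,
      mem_nhdsWithin_of_mem_nhds (c.preimage_closedBall_mem_nhds ⟨hp, hc⟩ hr)] with y h1 h2
    exact ⟨h2.1, h1, h2.2⟩
  · have h := c.integrableOn_comp_ψ hΓ.measurableSet Metric.isClosed_closedBall.measurableSet
      (isCompact_closedBall _ _) hrU (g := fun _ => 1)
      (integrableOn_const (measure_closedBall_lt_top.ne))
    rw [integrableOn_const_iff] at h
    simpa using h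

theorem IsClosedC2Surface.isFiniteMeasure_area (hΓ : IsClosedC2Surface Γ) :
    IsFiniteMeasure (area Γ) := ⟨by simpa [area] using hΓ.area_lt_top⟩

theorem ae_area_ne (Γ : Set E3) (x : E3) : ∀ᵐ y ∂area Γ, y ≠ x := by
  have : (μHE[2] : Measure E3) {x} = 0 := by
    rw [Measure.euclideanHausdorffMeasure_def, Measure.smul_apply]
    have : NullSingletonClass (μH[((2 : ℕ) : ℝ)] : Measure E3) :=
      Measure.nullSingletonClass_hausdorff _ (by norm_num)
    rw [measure_singleton, smul_zero]
  exact ae_restrict_of_ae (measure_eq_zero_iff_ae_notMem.1 this)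

/-- Near `x` the inverse chart is Lipschitz, so `1/‖x - y‖` is at most a constant times `1/‖ψ y - ψ
x‖`, which is integrable in the plane. Away from `x` it is bounded and the area is finite. -/
theorem IsClosedC2Surface.integrable_norm_inv (hΓ : IsClosedC2Surface Γ) {x : E3} (hx : x ∈ Γ) :
    Integrable (fun y => ‖x - y‖⁻¹) (area Γ) := by
  have hfin := hΓ.isFiniteMeasure_area
  obtain ⟨c, hc⟩ := hΓ.exists_chart hx
  obtain ⟨r, hr, hrU⟩ := c.exists_closedBall_subset_dom ⟨hx, hc⟩
  obtain ⟨K, V, hV, hK⟩ := (((c.contDiffOn_ψ.of_le one_le_two).contDiffAt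
    (c.isOpen_source.mem_nhds hc))).exists_lipschitzOnWith
  have hmeas : AEStronglyMeasurable (fun y : E3 => ‖x - y‖⁻¹) (area Γ) :=
    (measurable_const.sub measurable_id).norm.inv.aestronglyMeasurable
  obtain ⟨δ, hδ, hball⟩ := Metric.mem_nhds_iff.1
    (inter_mem (c.preimage_closedBall_mem_nhds ⟨hx, hc⟩ hr) hV)
  have hB : IntegrableOn (fun u : E2 => ‖u - c.ψ x‖⁻¹) (Metric.closedBall (c.ψ x) r) := by
    have h0 : LocallyIntegrable (fun u : E2 => ‖u‖⁻¹) :=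
      locallyIntegrable_of_norm_le_rpow (C := 1) (α := 1) (by simp) (by simp)
        (Eventually.of_forall fun u => by simp [Real.rpow_neg_one])
        measurable_norm.inv.aestronglyMeasurable
    have h1 := h0.integrableOn_isCompact (isCompact_closedBall (0 : E2) r)
    have h2 := (measurePreserving_sub_right (volume : Measure E2) (c.ψ x)).integrableOn_comp_preimage
      (MeasurableEquiv.subRight (c.ψ x)).measurableEmbedding (f := fun u : E2 => ‖u‖⁻¹)
      (s := Metric.closedBall 0 r)
    have h3 := h2.2 h1
    have h4 : (fun u => u - c.ψ x) ⁻¹' Metric.closedBall 0 r = Metric.closedBall (c.ψ x) r := by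
      ext u; simp [dist_eq_norm]
    rw [h4] at h3
    exact h3
  have h1 := c.integrableOn_comp_ψ hΓ.measurableSet Metric.isClosed_closedBall.measurableSet
      (isCompact_closedBall _ _) hrU hB
  have hnear : IntegrableOn (fun y => ‖x - y‖⁻¹) (Metric.ball x δ) (area Γ) := by
    have h2 : IntegrableOn (fun y => K * ‖c.ψ y - c.ψ x‖⁻¹) (Metric.ball x δ ∩ Γ) μHE[2] :=
      (h1.mono_set fun y hy => ⟨(hball hy.1).1.1, hy.2, (hball hy.1).1.2⟩).const_mul _
    rw [IntegrableOn, area, Measure.restrict_restrict measurableSet_ball]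
    refine Integrable.mono' h2 (measurable_const.sub
      measurable_id).norm.inv.aestronglyMeasurable ?_
    filter_upwards [ae_restrict_mem (measurableSet_ball.inter hΓ.measurableSet)] with y hy
    rw [norm_inv, norm_norm]
    -- At `y = x` both sides are zero, because `0⁻¹ = 0`.
    rcases eq_or_ne y x with rfl | hyx
    · simp
    have hpos : 0 < ‖x - y‖ := norm_pos_iff.2 (sub_ne_zero.2 hyx.symm)
    have hL := hK.dist_le_mul y (hball hy.1).2 x (mem_of_mem_nhds hV)
    rw [dist_eq_norm, dist_eq_norm, norm_sub_rev y x] at hL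
    have hne : c.ψ y ≠ c.ψ x := fun h => hyx (by
      rw [← c.φ_ψ y ⟨hy.2, (hball hy.1).1.2⟩, h, c.φ_ψ x ⟨hx, hc⟩])
    have hpos' : 0 < ‖c.ψ y - c.ψ x‖ := norm_pos_iff.2 (sub_ne_zero.2 hne)
    rw [← div_eq_mul_inv, le_div_iff₀ hpos', inv_mul_le_iff₀ hpos, mul_comm]
    exact hL
  have hfar : IntegrableOn (fun y => ‖x - y‖⁻¹) (Metric.ball x δ)ᶜ (area Γ) := by
    refine Integrable.mono' (integrable_const δ⁻¹) hmeas.restrict ?_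
    filter_upwards [ae_restrict_mem measurableSet_ball.compl] with y hy
    rw [Set.mem_compl_iff, Metric.mem_ball, not_lt, dist_eq_norm, norm_sub_rev] at hy
    rw [norm_inv, norm_norm]
    exact inv_anti₀ hδ hy
  exact integrableOn_univ.1 (by
    rw [← Set.union_compl_self (Metric.ball x δ)]; exact hnear.union hfar)

/-! ### Directional derivatives of compactly supported functions on a parameter domain -/

/-- `X` has the continuous directional derivative `X'` along `v` on `D`. -/
structure HasContLineDerivOn {F : Type*} [NormedAddCommGroup F] [NormedSpace ℝ F] (D : Set E2)
    (v : E2) (X X' : E2 → F) : Prop where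
  hasLineDerivAt : ∀ u ∈ D, HasLineDerivAt ℝ X (X' u) u v
  continuousOn : ContinuousOn X D
  continuousOn' : ContinuousOn X' D

theorem hasContLineDerivOn_of_contDiffOn {F : Type*} [NormedAddCommGroup F] [NormedSpace ℝ F]
    {D : Set E2} (hD : IsOpen D) {X : E2 → F} (hX : ContDiffOn ℝ 1 X D) (v : E2) :
    HasContLineDerivOn D v X fun u => fderiv ℝ X u v where
  hasLineDerivAt _ hu := ((hX.contDiffAt (hD.mem_nhds hu)).differentiableAt
    one_ne_zero).hasFDerivAt.hasLineDerivAt v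
  continuousOn := hX.continuousOn
  continuousOn' := (hX.continuousOn_fderiv_of_isOpen hD le_rfl).clm_apply continuousOn_const

theorem hasDerivAt_inner_cross {a b c : ℝ → E3} {a' b' c' : E3} {t : ℝ} (ha : HasDerivAt a a' t)
    (hb : HasDerivAt b b' t) (hc : HasDerivAt c c' t) :
    HasDerivAt (fun t => inner ℝ (a t) (cross (b t) (c t)))
      (inner ℝ a' (cross (b t) (c t)) + inner ℝ (a t) (cross b' (c t)) +
        inner ℝ (a t) (cross (b t) c')) t := by
  have coord {x : ℝ → E3} {x' : E3} (hx : HasDerivAt x x' t) (i : Fin 3) :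
      HasDerivAt (fun t => x t i) (x' i) t :=
    (EuclideanSpace.proj (𝕜 := ℝ) i).hasFDerivAt.comp_hasDerivAt t hx
  simp only [inner_eq_sum, cross_apply_zero, cross_apply_one, cross_apply_two]
  refine HasDerivAt.congr_deriv ((((coord ha 0).mul (((coord hb 1).mul (coord hc 2)).sub
    ((coord hb 2).mul (coord hc 1)))).add ((coord ha 1).mul (((coord hb 2).mul (coord hc 0)).sub
    ((coord hb 0).mul (coord hc 2))))).add ((coord ha 2).mul (((coord hb 0).mul (coord hc 1)).sub
    ((coord hb 1).mul (coord hc 0))))) ?_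
  simp only [Pi.mul_apply, Pi.sub_apply]
  ring

theorem HasContLineDerivOn.inner_cross {D : Set E2} {v : E2} {a b c a' b' c' : E2 → E3}
    (ha : HasContLineDerivOn D v a a') (hb : HasContLineDerivOn D v b b')
    (hc : HasContLineDerivOn D v c c') :
    HasContLineDerivOn D v (fun u => inner ℝ (a u) (cross (b u) (c u))) fun u =>
      inner ℝ (a' u) (cross (b u) (c u)) + inner ℝ (a u) (cross (b' u) (c u)) +
        inner ℝ (a u) (cross (b u) (c' u)) where
  hasLineDerivAt u hu := by
    have h := hasDerivAt_inner_cross (ha.hasLineDerivAt u hu) (hb.hasLineDerivAt u hu)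
      (hc.hasLineDerivAt u hu)
    simp only [zero_smul, add_zero] at h
    exact h
  continuousOn := ha.continuousOn.inner
    (continuous_cross.comp_continuousOn (hb.continuousOn.prodMk hc.continuousOn))
  continuousOn' :=
    ((ha.continuousOn'.inner (continuous_cross.comp_continuousOn
      (hb.continuousOn.prodMk hc.continuousOn))).add
    (ha.continuousOn.inner (continuous_cross.comp_continuousOn
      (hb.continuousOn'.prodMk hc.continuousOn)))).add
    (ha.continuousOn.inner (continuous_cross.comp_continuousOn
      (hb.continuousOn.prodMk hc.continuousOn')))

theorem HasContLineDerivOn.smul {D : Set E2} {v : E2} {g g' : E2 → ℝ} {s s' : E2 → ℂ}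
    (hg : HasContLineDerivOn D v g g') (hs : HasContLineDerivOn D v s s') :
    HasContLineDerivOn D v (fun u => g u • s u) fun u => g u • s' u + g' u • s u where
  hasLineDerivAt u hu := by
    have h := HasDerivAt.fun_smul (hg.hasLineDerivAt u hu) (hs.hasLineDerivAt u hu)
    simp only [zero_smul, add_zero] at h
    exact h
  continuousOn := hg.continuousOn.smul hs.continuousOn
  continuousOn' := (hg.continuousOn.smul hs.continuousOn').add
    (hg.continuousOn'.smul hs.continuousOn)

/-- A directional derivative of a function with compact support integrates to zero. -/
theorem HasContLineDerivOn.integral_eq_zero {D K : Set E2} {v : E2} {w w' : E2 → ℂ}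
    (hw : HasContLineDerivOn D v w w') (hD : IsOpen D) (hK : IsCompact K) (hKD : K ⊆ D)
    (h0 : ∀ u ∈ D \ K, w u = 0) : IntegrableOn w' D ∧ ∫ u in D, w' u = 0 := by
  have h0' : ∀ u ∈ D \ K, w' u = 0 := by
    intro u hu
    have h1 : HasLineDerivAt ℝ w 0 u v := by
      have h2 : HasFDerivAt w (0 : E2 →L[ℝ] ℂ) u := by
        refine (hasFDerivAt_const (0 : ℂ) u).congr_of_eventuallyEq ?_
        filter_upwards [(hD.sdiff hK.isClosed).mem_nhds hu] with x hx using h0 x hx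
      exact h2.hasLineDerivAt v
    exact (hw.hasLineDerivAt u hu.1).unique h1
  have hint {g : E2 → ℂ} (hg : ContinuousOn g D) (hg0 : ∀ u ∈ D \ K, g u = 0) :
      Integrable (D.indicator g) := by
    have h1 : D.indicator g = K.indicator g := by
      ext u
      by_cases hu : u ∈ K
      · simp [hu, hKD hu]
      · by_cases hu' : u ∈ D
        · simp [hu, hu', hg0 u ⟨hu', hu⟩]
        · simp [hu, hu']
    rw [h1, integrable_indicator_iff hK.measurableSet]
    exact (hg.mono hKD).integrableOn_compact hK
  have hi := hint hw.continuousOn h0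
  have hi' := hint hw.continuousOn' h0'
  refine ⟨(integrable_indicator_iff hD.measurableSet).1 hi', ?_⟩
  have hder : ∀ u, HasLineDerivAt ℝ (D.indicator w) (D.indicator w' u) u v := by
    intro u
    by_cases hu : u ∈ D
    · rw [Set.indicator_of_mem hu]
      refine (hw.hasLineDerivAt u hu).congr_of_eventuallyEq ?_
      filter_upwards [hD.mem_nhds hu] with x hx using Set.indicator_of_mem hx w
    -- A point outside `D`, boundary points included, has a neighbourhood that misses the compact
    -- set `K`; the extension by zero vanishes there.
    · rw [Set.indicator_of_notMem hu]
      have h2 : HasFDerivAt (D.indicator w) (0 : E2 →L[ℝ] ℂ) u := by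
        refine (hasFDerivAt_const (0 : ℂ) u).congr_of_eventuallyEq ?_
        filter_upwards [hK.isClosed.isOpen_compl.mem_nhds fun h => hu (hKD h)] with x hx
        by_cases hx' : x ∈ D
        · rw [Set.indicator_of_mem hx', h0 x ⟨hx', hx⟩]
        · exact Set.indicator_of_notMem hx' w
      exact h2.hasLineDerivAt v
  -- Integration by parts against the constant `1`, whose derivative is zero.
  have key := integral_bilinear_hasLineDerivAt_right_eq_neg_left_of_integrable (μ := volume)
    (f := fun _ : E2 => (1 : ℂ)) (f' := fun _ => 0) (g := D.indicator w) (g' := D.indicator w')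
    (v := v) (B := ContinuousLinearMap.mul ℝ ℂ) (by simp) (by simpa using hi')
    (by simpa using hi) (fun x _ => by
      have := (hasFDerivAt_const (1 : ℂ) x).hasLineDerivAt (𝕜 := ℝ) v
      simpa using this) (fun x _ => hder x)
  rw [← integral_indicator hD.measurableSet]
  simpa using key

/-! ### The divergence theorem -/

section Divergence

variable {Γ : Set E3} {τ : Fin 2 → E3 → E3}

/-- The expansion `n × (b × c) = (n · c) b - (n · b) c` vanishes, so `b × c` has no part orthogonal
to `n`. -/
theorem inner_self_smul_of_inner_eq_zero {n b c : E3} (hn : ‖n‖ = 1) (hb : inner ℝ n b = 0)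
    (hc : inner ℝ n c = 0) : cross b c = inner ℝ n (cross b c) • n := by
  have h := cross_cross_self n (cross b c)
  have h0 : cross n (cross b c) = inner ℝ n c • b - inner ℝ n b • c := by
    refine ext_three ?_ ?_ ?_ <;>
    · simp only [inner_eq_sum, cross_apply_zero, cross_apply_one, cross_apply_two, PiLp.sub_apply,
        PiLp.smul_apply, smul_eq_mul]
      ring
  have hz : cross (0 : E3) n = 0 := by
    refine ext_three ?_ ?_ ?_ <;>
      simp [cross_apply_zero, cross_apply_one, cross_apply_two]
  rw [h0, hb, hc, zero_smul, zero_smul, sub_zero, hz, hn, one_pow, one_smul] at h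
  exact (sub_eq_zero.1 h.symm)

namespace SurfaceChart

variable (c : SurfaceChart Γ)

/-- The unit normal in a chart. -/
noncomputable def nu (u : E2) : E3 :=
  ‖cross (c.dφ 0 u) (c.dφ 1 u)‖⁻¹ • cross (c.dφ 0 u) (c.dφ 1 u)

theorem contDiff_cross : ContDiff ℝ 1 fun p : E3 × E3 => cross p.1 p.2 := by
  have h : ∀ i : Fin 3, ContDiff ℝ 1 fun p : E3 × E3 => cross p.1 p.2 i := by
    have c1 (i : Fin 3) : ContDiff ℝ 1 fun p : E3 × E3 => p.1 i :=
      (EuclideanSpace.proj (𝕜 := ℝ) i).contDiff.comp contDiff_fst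
    have c2 (i : Fin 3) : ContDiff ℝ 1 fun p : E3 × E3 => p.2 i :=
      (EuclideanSpace.proj (𝕜 := ℝ) i).contDiff.comp contDiff_snd
    intro i
    fin_cases i
    · simp only [Fin.zero_eta, cross_apply_zero]
      exact ((c1 1).mul (c2 2)).sub ((c1 2).mul (c2 1))
    · simp only [Fin.mk_one, cross_apply_one]
      exact ((c1 2).mul (c2 0)).sub ((c1 0).mul (c2 2))
    · simp only [Fin.reduceFinMk, cross_apply_two]
      exact ((c1 0).mul (c2 1)).sub ((c1 1).mul (c2 0))
  exact contDiff_euclidean.2 h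

theorem contDiffOn_nu : ContDiffOn ℝ 1 c.nu c.dom := by
  have hm : ContDiffOn ℝ 1 (fun u => cross (c.dφ 0 u) (c.dφ 1 u)) c.dom :=
    contDiff_cross.comp_contDiffOn ((c.contDiffOn_dφ 0).prodMk (c.contDiffOn_dφ 1))
  exact ((hm.norm ℝ fun u hu => c.cross_dφ_ne_zero hu).inv
    fun u hu => norm_ne_zero_iff.2 (c.cross_dφ_ne_zero hu)).smul hm

theorem inner_nu_cross {u : E2} (hu : u ∈ c.dom) :
    inner ℝ (c.nu u) (cross (c.dφ 0 u) (c.dφ 1 u)) = jac c.φ u := by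
  have h := norm_ne_zero_iff.2 (c.cross_dφ_ne_zero hu)
  rw [nu, inner_smul_left, real_inner_self_eq_norm_sq, conj_trivial]
  rw [sq, ← mul_assoc, inv_mul_cancel₀ h, one_mul]
  rfl

/-- Differentiating `ν · ν = 1` shows that a derivative of `ν` is orthogonal to `ν`, hence to the
parallel vector `φ₀ × φ₁`. -/
theorem inner_fderiv_nu_cross {u : E2} (hu : u ∈ c.dom) (v : E2) :
    inner ℝ (fderiv ℝ c.nu u v) (cross (c.dφ 0 u) (c.dφ 1 u)) = 0 := by
  have hn : HasFDerivAt c.nu (fderiv ℝ c.nu u) u :=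
    ((c.contDiffOn_nu.contDiffAt (c.isOpen_dom.mem_nhds hu)).differentiableAt
      one_ne_zero).hasFDerivAt
  have h1 := (hn.inner ℝ hn).hasLineDerivAt v
  have h2 : HasLineDerivAt ℝ (fun u => inner ℝ (c.nu u) (c.nu u)) (0 : ℝ) u v := by
    have h3 : HasFDerivAt (fun u => inner ℝ (c.nu u) (c.nu u)) (0 : E2 →L[ℝ] ℝ) u := by
      refine (hasFDerivAt_const (1 : ℝ) u).congr_of_eventuallyEq ?_
      filter_upwards [c.isOpen_dom.mem_nhds hu] with x hx
      rw [real_inner_self_eq_norm_sq, nu, norm_smul, norm_inv, norm_norm,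
        inv_mul_cancel₀ (norm_ne_zero_iff.2 (c.cross_dφ_ne_zero hx)), one_pow]
    exact h3.hasLineDerivAt v
  have h4 := h1.unique h2
  simp only [ContinuousLinearMap.comp_apply, ContinuousLinearMap.prod_apply,
    fderivInnerCLM_apply] at h4
  rw [real_inner_comm (fderiv ℝ c.nu u v) (c.nu u)] at h4
  have h5 : inner ℝ (fderiv ℝ c.nu u v) (c.nu u) = 0 := by linarith
  rw [nu, inner_smul_right] at h5
  exact (mul_eq_zero.1 h5).resolve_left
    (inv_ne_zero (norm_ne_zero_iff.2 (c.cross_dφ_ne_zero hu)))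

theorem dφ_mem_tangentPlane (i : Fin 2) {u : E2} (hu : u ∈ c.dom) :
    c.dφ i u ∈ tangentPlane Γ (c.φ u) := c.fderiv_φ_mem_tangentPlane hu _

theorem cross_dφ_eq_smul (hΓ : IsClosedC2Surface Γ) (hτ : IsTangentFrame Γ τ) {u : E2}
    (hu : u ∈ c.dom) : cross (c.dφ 0 u) (c.dφ 1 u) =
      inner ℝ (normal τ (c.φ u)) (cross (c.dφ 0 u) (c.dφ 1 u)) • normal τ (c.φ u) := by
  have hy := (c.φ_mem u hu).1
  exact inner_self_smul_of_inner_eq_zero (norm_normal hτ hy)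
    ((mem_tangentPlane_iff hΓ hτ hy).1 (c.dφ_mem_tangentPlane 0 hu))
    ((mem_tangentPlane_iff hΓ hτ hy).1 (c.dφ_mem_tangentPlane 1 hu))

theorem starProjection_nu (hΓ : IsClosedC2Surface Γ) (hτ : IsTangentFrame Γ τ) {u : E2}
    (hu : u ∈ c.dom) : (tangentPlane Γ (c.φ u)).starProjection (c.nu u) = 0 := by
  have hy := (c.φ_mem u hu).1
  rw [nu, map_smul, starProjection_tangentPlane hΓ hτ hy, ← c.cross_dφ_eq_smul hΓ hτ hu, sub_self,
    smul_zero]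

theorem exists_eq_add_of_mem_tangentPlane (hΓ : IsClosedC2Surface Γ) (hτ : IsTangentFrame Γ τ)
    {u : E2} (hu : u ∈ c.dom) {v : E3} (hv : v ∈ tangentPlane Γ (c.φ u)) :
    ∃ a b : ℝ, v = a • c.dφ 0 u + b • c.dφ 1 u := by
  refine exists_eq_add_of_inner_cross_eq_zero (c.cross_dφ_ne_zero hu) ?_
  rw [c.cross_dφ_eq_smul hΓ hτ hu, inner_smul_left,
    (mem_tangentPlane_iff hΓ hτ (c.φ_mem u hu).1).1 hv, mul_zero]

theorem hasContLineDerivOn_comp {F : Type*} [NormedAddCommGroup F] [NormedSpace ℝ F] {f : E3 → F}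
    (hf : IsC1Along Γ f) (i : Fin 2) :
    HasContLineDerivOn c.dom (e2 i) (fun u => f (c.φ u))
      fun u => surfDeriv Γ f (c.φ u) (c.dφ i u) where
  hasLineDerivAt u hu := by
    have hy := (c.φ_mem u hu).1
    have h1 := (hf.1 _ hy).hasFDerivWithinAt.comp_hasFDerivAt u (c.hasFDerivAt_φ hu) (by
      filter_upwards [c.isOpen_dom.mem_nhds hu] with v hv using (c.φ_mem v hv).1)
    have h2 := h1.hasLineDerivAt (e2 i)
    rw [surfDeriv_apply_of_mem (c.dφ_mem_tangentPlane i hu)]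
    exact h2
  continuousOn := hf.continuousOn.comp c.contDiffOn_φ.continuousOn fun u hu => (c.φ_mem u hu).1
  continuousOn' := (hf.2.comp c.contDiffOn_φ.continuousOn fun u hu => (c.φ_mem u hu).1).clm_apply
    (c.contDiffOn_dφ i).continuousOn

theorem fderiv_dφ_comm {u : E2} (hu : u ∈ c.dom) (i j : Fin 2) :
    fderiv ℝ (c.dφ i) u (e2 j) = fderiv ℝ (c.dφ j) u (e2 i) := by
  have h1 := (c.contDiffOn_φ.contDiffAt (c.isOpen_dom.mem_nhds hu)).isSymmSndFDerivAt (by simp)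
  have h2 (k : Fin 2) (v : E2) : fderiv ℝ (c.dφ k) u v = fderiv ℝ (fderiv ℝ c.φ) u v (e2 k) := by
    have h3 : HasFDerivAt (fderiv ℝ c.φ) (fderiv ℝ (fderiv ℝ c.φ) u) u :=
      ((c.contDiffOn_fderiv_φ.contDiffAt (c.isOpen_dom.mem_nhds hu)).differentiableAt
        one_ne_zero).hasFDerivAt
    have h4 := h3.clm_apply (hasFDerivAt_const (e2 k) u)
    have h5 : fderiv ℝ (c.dφ k) u = _ := h4.fderiv
    rw [h5]
    simp
  rw [h2, h2]
  exact h1 _ _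

/-- The divergence theorem for fields supported in a chart. -/
theorem integral_div_eq_zero (hΓ : IsClosedC2Surface Γ) (hτ : IsTangentFrame Γ τ)
    {J : E3 → E3} (hJ : IsC1Along Γ J) (hJt : ∀ y ∈ Γ, J y ∈ tangentPlane Γ y)
    {s : E3 → ℂ} (hs : IsC1Along Γ s) {C : Set E3} (hC : IsCompact C) (hCs : C ⊆ c.source)
    (hs0 : ∀ y ∈ Γ \ C, s y = 0) :
    ∫ y in Γ, (s y * (surfDiv Γ J y : ℂ) + surfDeriv Γ s y (J y)) ∂μHE[2] = 0 := by
  have hcont : ContinuousOn (fun y => s y * (surfDiv Γ J y : ℂ) + surfDeriv Γ s y (J y)) Γ :=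
    (hs.continuousOn.mul (Complex.continuous_ofReal.comp_continuousOn hJ.continuousOn_surfDiv)).add
      (hs.2.clm_apply hJ.continuousOn)
  have hms : MeasurableSet (Γ ∩ c.source) :=
    hΓ.measurableSet.inter c.isOpen_source.measurableSet
  have hred : ∫ y in Γ, (s y * (surfDiv Γ J y : ℂ) + surfDeriv Γ s y (J y)) ∂μHE[2] =
      ∫ y in Γ ∩ c.source, (s y * (surfDiv Γ J y : ℂ) + surfDeriv Γ s y (J y)) ∂μHE[2] := by
    refine setIntegral_eq_of_subset_of_forall_sdiff_eq_zero hΓ.measurableSet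
      Set.inter_subset_left fun y hy => ?_
    have hyC : y ∉ C := fun h => hy.2 ⟨hy.1, hCs h⟩
    have h0 : surfDeriv Γ s y = 0 := by
      have h1 : HasFDerivWithinAt s (0 : E3 →L[ℝ] ℂ) Γ y := by
        refine (hasFDerivWithinAt_const (0 : ℂ) y Γ).congr_of_eventuallyEq ?_ (hs0 y ⟨hy.1, hyC⟩)
        filter_upwards [self_mem_nhdsWithin,
          mem_nhdsWithin_of_mem_nhds (hC.isClosed.isOpen_compl.mem_nhds hyC)] with z hz hz'
        exact hs0 z ⟨hz, hz'⟩
      rw [surfDeriv_eq h1, ContinuousLinearMap.zero_comp]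
    rw [hs0 y ⟨hy.1, hyC⟩, h0]
    simp
  rw [hred, c.setIntegral_eq hΓ.measurableSet (hcont.mono Set.inter_subset_left)]
  have hK : IsCompact (c.ψ '' (Γ ∩ C)) :=
    (hΓ.isCompact.inter hC).image_of_continuousOn
      (c.contDiffOn_ψ.continuousOn.mono fun y hy => hCs hy.2)
  have hKD : c.ψ '' (Γ ∩ C) ⊆ c.dom := by
    rintro _ ⟨y, hy, rfl⟩
    exact c.ψ_mem y ⟨hy.1, hCs hy.2⟩
  have hs0' : ∀ u ∈ c.dom \ c.ψ '' (Γ ∩ C), s (c.φ u) = 0 := fun u hu =>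
    hs0 _ ⟨(c.φ_mem u hu.1).1, fun h => hu.2 ⟨c.φ u, ⟨(c.φ_mem u hu.1).1, h⟩, c.ψ_φ u hu.1⟩⟩
  have hν (i : Fin 2) := hasContLineDerivOn_of_contDiffOn c.isOpen_dom c.contDiffOn_nu (e2 i)
  have hd (k i : Fin 2) :=
    hasContLineDerivOn_of_contDiffOn c.isOpen_dom (c.contDiffOn_dφ k) (e2 i)
  -- If `J = p φ₀ + q φ₁`, then `ν · (J × φ₁)` and `ν · (φ₀ × J)` are `p` and `q` times the area
  -- density. These are the components of the classical coordinate divergence; as triple products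
  -- they can be differentiated without regularity of `p` and `q`.
  have hW0 := ((hν 0).inner_cross (c.hasContLineDerivOn_comp hJ 0) (hd 1 0)).smul
    (c.hasContLineDerivOn_comp hs 0)
  have hW1 := ((hν 1).inner_cross (hd 0 1) (c.hasContLineDerivOn_comp hJ 1)).smul
    (c.hasContLineDerivOn_comp hs 1)
  obtain ⟨hi0, hz0⟩ := hW0.integral_eq_zero c.isOpen_dom hK hKD fun u hu => by
    rw [hs0' u hu, smul_zero]
  obtain ⟨hi1, hz1⟩ := hW1.integral_eq_zero c.isOpen_dom hK hKD fun u hu => by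
    rw [hs0' u hu, smul_zero]
  have hsum := integral_add hi0 hi1
  rw [hz0, hz1, add_zero] at hsum
  rw [← hsum]
  refine setIntegral_congr_fun c.isOpen_dom.measurableSet fun u hu => ?_
  have hy := (c.φ_mem u hu).1
  obtain ⟨p, q, hpq⟩ := c.exists_eq_add_of_mem_tangentPlane hΓ hτ hu (hJt _ hy)
  -- The surface differential kills `ν`, so the trace identity expresses `Div J` times the density
  -- by the terms with derivatives of `J`. The terms with derivatives of `ν` vanish, and those with
  -- second derivatives of `φ` cancel by symmetry.
  have htr := trace_mul_inner_cross (surfDeriv Γ J (c.φ u)) (c.nu u) (c.dφ 0 u) (c.dφ 1 u)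
  have hLν : surfDeriv Γ J (c.φ u) (c.nu u) = 0 := by
    rw [← surfDeriv_comp_starProjection, c.starProjection_nu hΓ hτ hu, map_zero]
  rw [hLν, inner_zero_left, zero_add, c.inner_nu_cross hu] at htr
  have hA0 := c.inner_fderiv_nu_cross hu (e2 0)
  have hA1 := c.inner_fderiv_nu_cross hu (e2 1)
  have hcomm := c.fderiv_dφ_comm hu 1 0
  have hjac := c.inner_nu_cross hu
  have hleft (w : E3) : inner ℝ w (cross (J (c.φ u)) (c.dφ 1 u)) =
      p * inner ℝ w (cross (c.dφ 0 u) (c.dφ 1 u)) := by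
    rw [hpq]
    simp only [inner_eq_sum, cross_apply_zero, cross_apply_one, cross_apply_two, PiLp.add_apply,
      PiLp.smul_apply, smul_eq_mul]
    ring
  have hright (w : E3) : inner ℝ w (cross (c.dφ 0 u) (J (c.φ u))) =
      q * inner ℝ w (cross (c.dφ 0 u) (c.dφ 1 u)) := by
    rw [hpq]
    simp only [inner_eq_sum, cross_apply_zero, cross_apply_one, cross_apply_two, PiLp.add_apply,
      PiLp.smul_apply, smul_eq_mul]
    ring
  have hanti (a w z : E3) : inner ℝ a (cross w z) = -inner ℝ a (cross z w) := by
    simp only [inner_eq_sum, cross_apply_zero, cross_apply_one, cross_apply_two]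
    ring
  have hs' : surfDeriv Γ s (c.φ u) (J (c.φ u)) =
      p • surfDeriv Γ s (c.φ u) (c.dφ 0 u) + q • surfDeriv Γ s (c.φ u) (c.dφ 1 u) := by
    rw [hpq, map_add, map_smul, map_smul]
  have htr' : surfDiv Γ J (c.φ u) * jac c.φ u = _ := htr
  simp only [hleft, hright, hA0, hA1, hs', hcomm, hjac,
    hanti (c.nu u) (fderiv ℝ (c.dφ 0) u (e2 1)) (J (c.φ u))]
  simp only [NNReal.smul_def, Complex.real_smul]
  have htrC := congrArg (fun r : ℝ => (r : ℂ)) htr'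
  push_cast at htrC ⊢
  linear_combination (s (c.φ u)) * htrC

end SurfaceChart

theorem surfDeriv_add {F : Type*} [NormedAddCommGroup F] [NormedSpace ℝ F] {f g : E3 → F} {y : E3}
    (hf : DifferentiableWithinAt ℝ f Γ y) (hg : DifferentiableWithinAt ℝ g Γ y) :
    surfDeriv Γ (fun z => f z + g z) y = surfDeriv Γ f y + surfDeriv Γ g y := by
  rw [surfDeriv_eq (hf.hasFDerivWithinAt.fun_add hg.hasFDerivWithinAt)]
  rfl

theorem IsC1Along.integrable_div (hΓ : IsClosedC2Surface Γ) {J : E3 → E3} (hJ : IsC1Along Γ J)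
    {s : E3 → ℂ} (hs : IsC1Along Γ s) :
    Integrable (fun y => s y * (surfDiv Γ J y : ℂ) + surfDeriv Γ s y (J y)) (area Γ) := by
  have hcont : ContinuousOn (fun y => s y * (surfDiv Γ J y : ℂ) + surfDeriv Γ s y (J y)) Γ :=
    (hs.continuousOn.mul (Complex.continuous_ofReal.comp_continuousOn hJ.continuousOn_surfDiv)).add
      (hs.2.clm_apply hJ.continuousOn)
  obtain ⟨C, hC⟩ := hΓ.isCompact.exists_bound_of_continuousOn hcont
  have := hΓ.isFiniteMeasure_area
  refine Integrable.mono' (integrable_const C)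
    (hcont.aestronglyMeasurable hΓ.measurableSet) ?_
  exact ae_restrict_of_forall_mem hΓ.measurableSet hC

/-- **Divergence theorem** on a closed surface: `∫ Div (s J) = 0` for tangential `J`. -/
theorem integral_div_eq_zero (hΓ : IsClosedC2Surface Γ) (hτ : IsTangentFrame Γ τ)
    {J : E3 → E3} (hJ : IsC1Along Γ J) (hJt : ∀ y ∈ Γ, J y ∈ tangentPlane Γ y)
    {s : E3 → ℂ} (hs : IsC1Along Γ s) :
    ∫ y, (s y * (surfDiv Γ J y : ℂ) + surfDeriv Γ s y (J y)) ∂area Γ = 0 := by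
  have hloc : ∀ p : Γ, ∃ c : SurfaceChart Γ, ∃ r > 0, Metric.closedBall p.1 (2 * r) ⊆ c.source := by
    intro p
    obtain ⟨c, hc⟩ := hΓ.exists_chart p.2
    obtain ⟨r, hr, h⟩ := Metric.nhds_basis_closedBall.mem_iff.1 (c.isOpen_source.mem_nhds hc)
    exact ⟨c, r / 2, half_pos hr, by rwa [mul_div_cancel₀ r two_ne_zero]⟩
  choose c r hr hcr using hloc
  -- Induction on the number of balls needed to cover the points where `s` is nonzero. It replaces a
  -- partition of unity: `χ s` lives in one chart, and `(1 - χ) s` no longer needs the ball of `p`.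
  have key : ∀ t : Finset Γ, ∀ s : E3 → ℂ, IsC1Along Γ s →
      (∀ y ∈ Γ, s y ≠ 0 → ∃ p ∈ t, y ∈ Metric.ball p.1 (r p)) →
      ∫ y, (s y * (surfDiv Γ J y : ℂ) + surfDeriv Γ s y (J y)) ∂area Γ = 0 := by
    intro t
    induction t using Finset.induction_on with
    | empty =>
      intro s hs h
      have hs0 : ∀ y ∈ Γ, s y = 0 := fun y hy => by
        by_contra h0
        obtain ⟨p, hp, -⟩ := h y hy h0
        simp at hp
      refine integral_eq_zero_of_ae (ae_restrict_of_forall_mem hΓ.measurableSet fun y hy => ?_)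
      have h1 : HasFDerivWithinAt s (0 : E3 →L[ℝ] ℂ) Γ y :=
        (hasFDerivWithinAt_const (0 : ℂ) y Γ).congr hs0 (hs0 y hy)
      simp [hs0 y hy, surfDeriv_eq h1]
    | insert p t hpt ih =>
      intro s hs h
      -- The bump is `1` on the ball of radius `r p` used for covering and vanishes off the ball of
      -- radius `2 * r p`, whose closure lies in the chart.
      let χ : ContDiffBump p.1 := ⟨r p, 2 * r p, hr p, by linarith [hr p]⟩
      have hχ : ContDiff ℝ 1 fun y => (χ y : ℂ) := Complex.ofRealCLM.contDiff.comp χ.contDiff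
      have h1 : IsC1Along Γ fun y => (χ y : ℂ) * s y := (ContDiff.isC1Along hΓ hτ hχ).mul hs
      have h2 : IsC1Along Γ fun y => (1 - (χ y : ℂ)) * s y :=
        (ContDiff.isC1Along hΓ hτ (contDiff_const.sub hχ)).mul hs
      have hI1 := (c p).integral_div_eq_zero hΓ hτ hJ hJt h1 (isCompact_closedBall p.1 (2 * r p))
        (hcr p) fun y hy => by
          have : χ y = 0 := χ.zero_of_le_dist (by
            have := hy.2
            rw [Metric.mem_closedBall, not_le] at this
            exact this.le)
          rw [this, Complex.ofReal_zero, zero_mul]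
      have hI2 := ih _ h2 fun y hy h0 => by
        obtain ⟨q, hq, hyq⟩ := h y hy (right_ne_zero_of_mul h0)
        rcases Finset.mem_insert.1 hq with rfl | hq
        · exfalso
          have : χ y = 1 := χ.one_of_mem_closedBall (Metric.ball_subset_closedBall hyq)
          simp [this] at h0
        · exact ⟨q, hq, hyq⟩
      have hadd := integral_add (hJ.integrable_div hΓ h1) (hJ.integrable_div hΓ h2)
      rw [hI2, add_zero] at hadd
      refine Eq.trans ?_ (hadd.trans hI1)
      refine integral_congr_ae (ae_restrict_of_forall_mem hΓ.measurableSet fun y hy => ?_)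
      have h3 := surfDeriv_add (h1.1 y hy) (h2.1 y hy)
      have h4 : (fun z => (χ z : ℂ) * s z + (1 - (χ z : ℂ)) * s z) = s := by ext z; ring
      rw [h4] at h3
      simp only [h3, add_apply]
      ring
  obtain ⟨t, ht⟩ := hΓ.isCompact.elim_finite_subcover (fun p : Γ => Metric.ball p.1 (r p))
    (fun p => Metric.isOpen_ball) fun p hp =>
      Set.mem_iUnion.2 ⟨⟨p, hp⟩, Metric.mem_ball_self (hr _)⟩
  refine key t s hs fun y hy _ => ?_
  obtain ⟨p, hp, hyp⟩ := Set.mem_iUnion₂.1 (ht hy)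
  exact ⟨p, hp, hyp⟩

end Divergence

/-! ### The kernels -/

/-- The radial profile of `G κ`. -/
noncomputable def radial (κ r : ℝ) : ℂ := Complex.exp (Complex.I * κ * r) / (4 * Real.pi * r)

/-- The derivative of `radial κ`, divided by the radius. -/
noncomputable def radialDeriv (κ r : ℝ) : ℂ :=
  Complex.exp (Complex.I * κ * r) * (Complex.I * κ * r - 1) / (4 * Real.pi * r ^ 3)

theorem G_eq_radial (κ : ℝ) (x y : E3) : G κ x y = radial κ ‖x - y‖ := rfl

theorem hasDerivAt_radial (κ : ℝ) {r : ℝ} (hr : r ≠ 0) :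
    HasDerivAt (radial κ) (r * radialDeriv κ r) r := by
  have hrc : (r : ℂ) ≠ 0 := Complex.ofReal_ne_zero.2 hr
  have hπ : (Real.pi : ℂ) ≠ 0 := Complex.ofReal_ne_zero.2 Real.pi_ne_zero
  have h0 : HasDerivAt (fun r : ℝ => (r : ℂ)) 1 r := Complex.ofRealCLM.hasDerivAt
  have h1 := (h0.const_mul (Complex.I * κ)).cexp
  have h2 := h1.div (h0.const_mul (4 * Real.pi : ℂ)) (by simp [hπ, hr])
  refine h2.congr_deriv ?_
  rw [radialDeriv]
  field_simp

theorem norm_cexp_I_mul (κ r : ℝ) : ‖Complex.exp (Complex.I * κ * r)‖ = 1 := by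
  rw [mul_assoc, mul_comm, ← Complex.ofReal_mul]
  exact Complex.norm_exp_ofReal_mul_I _

theorem norm_radial (κ : ℝ) {r : ℝ} (hr : 0 ≤ r) : ‖radial κ r‖ = (4 * Real.pi)⁻¹ * r⁻¹ := by
  rw [radial, norm_div, norm_cexp_I_mul, norm_mul, norm_mul, Complex.norm_real, Complex.norm_real,
    Real.norm_of_nonneg hr, Real.norm_of_nonneg Real.pi_pos.le]
  simp [mul_comm]

theorem norm_radialDeriv_le {κ r : ℝ} (hκ : 0 < κ) (hr : 0 < r) :
    ‖radialDeriv κ r‖ ≤ (κ * r + 1) / (4 * Real.pi * r ^ 3) := by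
  rw [radialDeriv, norm_div, norm_mul, norm_cexp_I_mul, one_mul, norm_mul, norm_mul, norm_pow,
    Complex.norm_real, Complex.norm_real, Real.norm_of_nonneg hr.le,
    Real.norm_of_nonneg Real.pi_pos.le]
  have h1 : ‖Complex.I * κ * r - 1‖ ≤ κ * r + 1 := by
    refine (norm_sub_le _ _).trans_eq ?_
    simp [abs_of_pos hκ, abs_of_pos hr]
  have h2 : ‖(4 : ℂ)‖ = 4 := by simp
  rw [h2]
  gcongr

theorem continuousOn_radial (κ : ℝ) : ContinuousOn (radial κ) {0}ᶜ := fun _ hr =>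
  (hasDerivAt_radial κ hr).continuousAt.continuousWithinAt

theorem continuousOn_radialDeriv (κ : ℝ) : ContinuousOn (radialDeriv κ) {0}ᶜ := by
  unfold radialDeriv
  refine ContinuousOn.div (by fun_prop) (by fun_prop) fun r hr => ?_
  have hr' : r ≠ 0 := hr
  simp [hr', Real.pi_ne_zero]

theorem hasFDerivAt_norm_sub {x y : E3} (hxy : y ≠ x) :
    HasFDerivAt (fun z => ‖z - x‖) (‖y - x‖⁻¹ • innerSL ℝ (y - x)) y := by
  have hpos : 0 < ‖y - x‖ := norm_pos_iff.2 (sub_ne_zero.2 hxy)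
  have h1 := ((hasFDerivAt_id y).sub_const x).norm_sq
  have h2 := h1.sqrt (by simpa using hpos.ne')
  have h3 : (fun z => √(‖id z - x‖ ^ 2)) = fun z => ‖z - x‖ := by
    ext z; simp [Real.sqrt_sq]
  rw [h3] at h2
  refine h2.congr_fderiv ?_
  ext v
  simp [Real.sqrt_sq]
  field_simp

theorem dGy_eq (κ : ℝ) {x y : E3} (hxy : y ≠ x) (v : E3) :
    dGy κ x y v = radialDeriv κ ‖x - y‖ * (inner ℝ (y - x) v : ℝ) := by
  have hpos : ‖y - x‖ ≠ 0 := norm_ne_zero_iff.2 (sub_ne_zero.2 hxy)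
  have h1 := (hasDerivAt_radial κ hpos).hasFDerivAt.comp y (hasFDerivAt_norm_sub hxy)
  have h2 : (fun z => G κ x z) = radial κ ∘ fun z => ‖z - x‖ := by
    ext z; rw [G_eq_radial, norm_sub_rev]; rfl
  rw [dGy, h2, h1.fderiv, norm_sub_rev x y]
  have hc : ((‖y - x‖ : ℝ) : ℂ) ≠ 0 := Complex.ofReal_ne_zero.2 hpos
  simp
  field_simp
  rw [inner_sub_left, Complex.ofReal_sub]

/-- The reflection `z ↦ x + y - z` exchanges `x` and `y` and has derivative `-1`. -/
theorem dGx_eq (κ : ℝ) (x y v : E3) : dGx κ x y v = -dGy κ x y v := by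
  have h2 : (fun z => G κ z y) = (fun z => G κ x z) ∘ fun z => x + y - z := by
    ext z
    simp only [Function.comp_apply, G_eq_radial]
    congr 2
    abel_nf
  have h3 : (fun z : E3 => x + y - z) x = y := by simp
  rw [dGx, dGy, h2]
  by_cases h : DifferentiableAt ℝ (fun z => G κ x z) y
  · have h4 : HasFDerivAt (fun z => G κ x z) (fderiv ℝ (fun z => G κ x z) y)
        ((fun z : E3 => x + y - z) x) := by rw [h3]; exact h.hasFDerivAt
    have h5 := h4.comp x ((hasFDerivAt_id x).const_sub (x + y))
    have h6 : fderiv ℝ ((fun z => G κ x z) ∘ fun z => x + y - z) x = _ := h5.fderiv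
    rw [h6]
    simp
  -- Without differentiability, both sides take the default value zero of `fderiv`.
  · have h7 : ¬ DifferentiableAt ℝ ((fun z => G κ x z) ∘ fun z => x + y - z) x := by
      intro hd
      apply h
      have h8 : DifferentiableAt ℝ (fun z : E3 => x + y - z) y := by fun_prop
      have h9 : (fun z : E3 => x + y - z) y = x := by simp
      rw [← h9] at hd
      have := hd.comp y h8
      refine this.congr_of_eventuallyEq (Eventually.of_forall fun z => ?_)
      simp
    rw [fderiv_zero_of_not_differentiableAt h, fderiv_zero_of_not_differentiableAt h7]
    simp

theorem norm_toC (v : E3) : ‖toC v‖ = ‖v‖ := by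
  simp [toC, EuclideanSpace.norm_eq]

theorem continuous_toC : Continuous toC := by
  unfold toC
  fun_prop

section Kernels

variable {Γ : Set E3} {τ : Fin 2 → E3 → E3}

theorem continuousOn_norm_sub_mapsTo (Γ : Set E3) (x : E3) :
    Set.MapsTo (fun y => ‖x - y‖) (Γ \ {x}) {0}ᶜ := fun y hy => by
  have : x - y ≠ 0 := sub_ne_zero.2 fun h => hy.2 h.symm
  simpa using this

theorem continuousOn_G (κ : ℝ) (x : E3) : ContinuousOn (G κ x) (Γ \ {x}) :=
  (continuousOn_radial κ).comp (by fun_prop) (continuousOn_norm_sub_mapsTo Γ x)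

theorem continuousOn_radialDeriv_norm (κ : ℝ) (x : E3) :
    ContinuousOn (fun y => radialDeriv κ ‖x - y‖) (Γ \ {x}) :=
  (continuousOn_radialDeriv κ).comp (by fun_prop) (continuousOn_norm_sub_mapsTo Γ x)

theorem norm_G (κ : ℝ) (x y : E3) : ‖G κ x y‖ = (4 * Real.pi)⁻¹ * ‖x - y‖⁻¹ :=
  norm_radial κ (norm_nonneg _)

theorem norm_tangential_le (hτ : IsTangentFrame Γ τ) (hΓ : IsClosedC2Surface Γ) {y : E3}
    (hy : y ∈ Γ) (a : E3) : ‖tangential τ a y‖ ≤ ‖a‖ := by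
  rw [tangential_eq hτ hy, ← starProjection_tangentPlane hΓ hτ hy]
  exact Submodule.norm_starProjection_apply_le _ _

theorem rpow_one_sub_two (x y : E3) : ‖x - y‖ ^ ((1 : ℝ) - 2) = ‖x - y‖⁻¹ := by
  rw [← Real.rpow_neg_one]; norm_num

theorem isWeaklySingular_of_le_inv {F : Type*} [NormedAddCommGroup F] {K : E3 → E3 → F} {M : ℝ}
    (hK : ∀ x ∈ Γ, ContinuousOn (K x) (Γ \ {x}))
    (hM : ∀ x ∈ Γ, ∀ y ∈ Γ, y ≠ x → ‖K x y‖ ≤ M * ‖x - y‖⁻¹) : IsWeaklySingular Γ K :=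
  ⟨hK, M, 1, one_pos, fun x hx y hy hxy => by rw [rpow_one_sub_two]; exact hM x hx y hy hxy⟩

theorem continuousOn_G_mul_surfDiv (hΓ : IsClosedC2Surface Γ) (hτ : IsTangentFrame Γ τ)
    (κ : ℝ) (x a : E3) :
    ContinuousOn (fun y => G κ x y * (surfDiv Γ (tangential τ a) y : ℂ)) (Γ \ {x}) :=
  (continuousOn_G κ x).mul (Complex.continuous_ofReal.comp_continuousOn
    ((isC1Along_tangential hΓ hτ a).continuousOn_surfDiv.mono Set.sdiff_subset))

theorem isWeaklySingular_G_mul_surfDiv (hΓ : IsClosedC2Surface Γ) (hτ : IsTangentFrame Γ τ)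
    (κ : ℝ) (i : Fin 2) :
    IsWeaklySingular Γ fun x y => G κ x y * (surfDiv Γ (tangential τ (τ i x)) y : ℂ) := by
  obtain ⟨C, hC⟩ := exists_abs_surfDiv_tangential_le hΓ hτ
  refine isWeaklySingular_of_le_inv (M := (4 * Real.pi)⁻¹ * C)
    (fun x hx => continuousOn_G_mul_surfDiv hΓ hτ κ x _) fun x hx y hy hxy => ?_
  have h1 := hC y hy (τ i x) ((hτ x hx).2.1 i).le
  rw [norm_mul, norm_G, Complex.norm_real, Real.norm_eq_abs]
  calc _ ≤ (4 * Real.pi)⁻¹ * ‖x - y‖⁻¹ * C := by gcongr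
    _ = _ := by ring

theorem isWeaklySingular_G_smul_tangential (hΓ : IsClosedC2Surface Γ) (hτ : IsTangentFrame Γ τ)
    (κ : ℝ) (i : Fin 2) :
    IsWeaklySingular Γ fun x y => G κ x y • toC (tangential τ (τ i x) y) := by
  refine isWeaklySingular_of_le_inv (M := (4 * Real.pi)⁻¹)
    (fun x hx => (continuousOn_G κ x).smul (continuous_toC.comp_continuousOn
      ((isC1Along_tangential hΓ hτ _).continuousOn.mono Set.sdiff_subset))) fun x hx y hy hxy => ?_
  rw [norm_smul, norm_G, norm_toC]
  have h1 := norm_tangential_le hτ hΓ hy (τ i x)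
  have h2 : ‖τ i x‖ = 1 := (hτ x hx).2.1 i
  rw [h2] at h1
  exact mul_le_of_le_one_right (by positivity) h1

/-- The kernel contains `n(y)` twice, so it can be written with the tangential projection; this
gives continuity in `y` for a discontinuous frame. -/
theorem dGy_normal_smul_normal (hΓ : IsClosedC2Surface Γ) (hτ : IsTangentFrame Γ τ) (κ : ℝ)
    {x y : E3} (hy : y ∈ Γ) (hxy : y ≠ x) :
    dGy κ x y (normal τ y) • toC (normal τ y) =
      radialDeriv κ ‖x - y‖ • toC (y - x - (tangentPlane Γ y).starProjection (y - x)) := by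
  rw [dGy_eq κ hxy, starProjection_tangentPlane hΓ hτ hy, sub_sub_cancel, mul_smul]
  congr 1
  rw [real_inner_comm]
  ext j
  simp [toC]

/-- The radial factor is of order `‖x - y‖⁻³`, and the quadratic bound for the normal component of a
chord gains two powers. -/
theorem exists_norm_dGy_normal_le (hΓ : IsClosedC2Surface Γ) (hτ : IsTangentFrame Γ τ) {κ : ℝ}
    (hκ : 0 < κ) : ∃ M : ℝ, ∀ x ∈ Γ, ∀ y ∈ Γ, y ≠ x →
      ‖dGy κ x y (normal τ y)‖ ≤ M * ‖x - y‖⁻¹ := by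
  obtain ⟨C, hC0, hC⟩ := exists_inner_normal_le hΓ hτ
  obtain ⟨D, hD⟩ := hΓ.isCompact.isBounded.exists_norm_le
  refine ⟨C * (κ * (D + D) + 1) / (4 * Real.pi), fun x hx y hy hxy => ?_⟩
  have hpos : 0 < ‖x - y‖ := norm_pos_iff.2 (sub_ne_zero.2 hxy.symm)
  have hle : ‖x - y‖ ≤ D + D := (norm_sub_le x y).trans (add_le_add (hD x hx) (hD y hy))
  rw [dGy_eq κ hxy, norm_mul, Complex.norm_real, Real.norm_eq_abs, real_inner_comm]
  have h1 : |inner ℝ (normal τ y) (y - x)| ≤ C * ‖x - y‖ ^ 2 := by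
    rw [← neg_sub x y, inner_neg_right, abs_neg]
    exact hC x hx y hy
  calc ‖radialDeriv κ ‖x - y‖‖ * |inner ℝ (normal τ y) (y - x)|
      ≤ (κ * ‖x - y‖ + 1) / (4 * Real.pi * ‖x - y‖ ^ 3) * (C * ‖x - y‖ ^ 2) :=
        mul_le_mul (norm_radialDeriv_le hκ hpos) h1 (abs_nonneg _) (by positivity)
    _ = C * (κ * ‖x - y‖ + 1) / (4 * Real.pi) * ‖x - y‖⁻¹ := by
        field_simp
    _ ≤ _ := by gcongr

theorem continuousOn_dGy_normal_smul_normal (hΓ : IsClosedC2Surface Γ) (hτ : IsTangentFrame Γ τ)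
    (κ : ℝ) (x : E3) :
    ContinuousOn (fun y => dGy κ x y (normal τ y) • toC (normal τ y)) (Γ \ {x}) := by
  have h : ContinuousOn (fun y => radialDeriv κ ‖x - y‖ •
      toC (y - x - (tangentPlane Γ y).starProjection (y - x))) (Γ \ {x}) := by
    refine (continuousOn_radialDeriv_norm κ x).smul (continuous_toC.comp_continuousOn ?_)
    have hyx : ContinuousOn (fun y : E3 => y - x) (Γ \ {x}) := by fun_prop
    exact hyx.sub (((continuousOn_starProjection hΓ hτ).mono Set.sdiff_subset).clm_apply hyx)
  exact h.congr fun y hy => dGy_normal_smul_normal hΓ hτ κ hy.1 hy.2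

theorem isWeaklySingular_dGy_normal (hΓ : IsClosedC2Surface Γ) (hτ : IsTangentFrame Γ τ) {κ : ℝ}
    (hκ : 0 < κ) :
    IsWeaklySingular Γ fun x y => dGy κ x y (normal τ y) • toC (normal τ y) := by
  obtain ⟨M, hM⟩ := exists_norm_dGy_normal_le hΓ hτ hκ
  refine isWeaklySingular_of_le_inv (M := M)
    (fun x _ => continuousOn_dGy_normal_smul_normal hΓ hτ κ x) fun x hx y hy hxy => ?_
  rw [norm_smul, norm_toC, norm_normal hτ hy, mul_one]
  exact hM x hx y hy hxy

/-- The singular point may be removed because points have zero area. -/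
theorem aestronglyMeasurable_area (hΓ : IsClosedC2Surface Γ) {F : Type*} [NormedAddCommGroup F]
    [NormedSpace ℝ F] [SecondCountableTopology F] {x : E3} {f : E3 → F}
    (hf : ContinuousOn f (Γ \ {x})) : AEStronglyMeasurable f (area Γ) := by
  have hm : MeasurableSet (Γ \ {x}) := hΓ.measurableSet.diff (measurableSet_singleton x)
  have h1 : AEStronglyMeasurable f (μHE[2].restrict (Γ \ {x})) := hf.aestronglyMeasurable hm
  have h2 : (area Γ) = μHE[2].restrict (Γ \ {x}) := by
    have h3 : (area Γ).restrict {x}ᶜ = area Γ :=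
      Measure.restrict_eq_self_of_ae_mem (ae_area_ne Γ x)
    rw [← h3, area, Measure.restrict_restrict (measurableSet_singleton x).compl,
      Set.sdiff_eq, Set.inter_comm]
  rwa [h2]

theorem ae_area_mem_diff (hΓ : IsClosedC2Surface Γ) (x : E3) : ∀ᵐ y ∂area Γ, y ∈ Γ \ {x} := by
  filter_upwards [ae_area_ne Γ x, ae_restrict_mem hΓ.measurableSet] with y h1 h2 using ⟨h2, h1⟩

theorem integrable_of_norm_le_inv (hΓ : IsClosedC2Surface Γ) {F : Type*} [NormedAddCommGroup F]
    [NormedSpace ℝ F] [SecondCountableTopology F] {x : E3} (hx : x ∈ Γ) {f : E3 → F} {M : ℝ}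
    (hf : ContinuousOn f (Γ \ {x})) (hM : ∀ y ∈ Γ, y ≠ x → ‖f y‖ ≤ M * ‖x - y‖⁻¹) :
    Integrable f (area Γ) := by
  refine Integrable.mono' ((hΓ.integrable_norm_inv hx).const_mul M)
    (aestronglyMeasurable_area hΓ hf) ?_
  filter_upwards [ae_area_mem_diff hΓ x] with y hy using hM y hy.1 hy.2

end Kernels

/-! ### Smooth truncation of the radius -/

/-- The square of the positive part is `C¹` across the threshold; for this reason `excess` enters
`truncDist` squared. -/
theorem hasDerivAt_posPart_sq (t : ℝ) : HasDerivAt (fun t : ℝ => max t 0 ^ 2) (2 * max t 0) t := by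
  rcases lt_trichotomy t 0 with h | rfl | h
  · rw [max_eq_right h.le, mul_zero]
    refine (hasDerivAt_const t (0 : ℝ)).congr_of_eventuallyEq ?_
    filter_upwards [gt_mem_nhds h] with s hs
    rw [max_eq_right hs.le]; norm_num
  · simp only [max_self, mul_zero]
    have h1 : (fun t : ℝ => max t 0 ^ 2) =O[𝓝 0] fun t => t ^ 2 :=
      Asymptotics.IsBigO.of_bound 1 (Eventually.of_forall fun s => by
        rw [one_mul, Real.norm_eq_abs, Real.norm_eq_abs, abs_pow, abs_pow]
        refine pow_le_pow_left₀ (abs_nonneg _) ?_ 2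
        rcases le_total s 0 with hs | hs
        · rw [max_eq_right hs]; simp
        · rw [max_eq_left hs])
    rw [hasDerivAt_iff_isLittleO]
    have h2 : (fun t : ℝ => t ^ 2) =o[𝓝 0] fun t : ℝ => t := by
      simpa using Asymptotics.isLittleO_pow_pow (𝕜 := ℝ) (show 1 < 2 by norm_num)
    simpa using h1.trans_isLittleO h2
  · rw [max_eq_left h.le]
    have h1 := hasDerivAt_pow 2 t
    simp only [Nat.cast_ofNat, Nat.add_one_sub_one, pow_one] at h1
    refine h1.congr_of_eventuallyEq ?_
    filter_upwards [lt_mem_nhds h] with s hs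
    rw [max_eq_left hs.le]

/-- The excess of the squared distance over `ε²`. -/
noncomputable def excess (ε : ℝ) (x y : E3) : ℝ := max (‖y - x‖ ^ 2 - ε ^ 2) 0

/-- A `C¹` approximation, for small `δ`, of the distance to `x` truncated below at `ε`. -/
noncomputable def truncDist (ε δ : ℝ) (x y : E3) : ℝ :=
  √(ε ^ 2 + (√(excess ε x y ^ 2 + δ ^ 2) - δ))

/-- A continuous approximation, for small `δ`, of the indicator of the set `ε < ‖y - x‖`. -/
noncomputable def truncSlope (ε δ : ℝ) (x y : E3) : ℝ :=
  excess ε x y / √(excess ε x y ^ 2 + δ ^ 2)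

theorem excess_nonneg (ε : ℝ) (x y : E3) : 0 ≤ excess ε x y := le_max_right _ _

theorem continuous_excess (ε : ℝ) (x : E3) : Continuous (excess ε x) := by
  unfold excess
  fun_prop

theorem le_sqrt_sq_add_sq (δ t : ℝ) : δ ≤ √(t ^ 2 + δ ^ 2) :=
  Real.le_sqrt_of_sq_le (by nlinarith [sq_nonneg t])

theorem le_truncDist (ε δ : ℝ) (x y : E3) : ε ≤ truncDist ε δ x y :=
  Real.le_sqrt_of_sq_le (by linarith [le_sqrt_sq_add_sq δ (excess ε x y)])

theorem continuous_truncDist (ε δ : ℝ) (x : E3) : Continuous (truncDist ε δ x) := by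
  have := continuous_excess ε x
  unfold truncDist
  fun_prop

theorem continuous_truncSlope (ε : ℝ) {δ : ℝ} (hδ : 0 < δ) (x : E3) :
    Continuous (truncSlope ε δ x) := by
  have := continuous_excess ε x
  unfold truncSlope
  refine this.div (by fun_prop) fun y => ?_
  exact (hδ.trans_le (le_sqrt_sq_add_sq δ _)).ne'

theorem truncSlope_nonneg (ε δ : ℝ) (x y : E3) : 0 ≤ truncSlope ε δ x y :=
  div_nonneg (excess_nonneg ε x y) (Real.sqrt_nonneg _)

theorem truncSlope_le_one (ε δ : ℝ) (x y : E3) : truncSlope ε δ x y ≤ 1 :=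
  div_le_one_of_le₀ (Real.le_sqrt_of_sq_le (by nlinarith [sq_nonneg δ])) (Real.sqrt_nonneg _)

theorem hasFDerivAt_truncDist {ε δ : ℝ} (hε : 0 < ε) (hδ : 0 < δ) (x y : E3) :
    HasFDerivAt (truncDist ε δ x)
      ((truncSlope ε δ x y / truncDist ε δ x y) • innerSL ℝ (y - x)) y := by
  have h1 := (((hasFDerivAt_id y).sub_const x).norm_sq).sub_const (ε ^ 2)
  have h2 := (hasDerivAt_posPart_sq (‖y - x‖ ^ 2 - ε ^ 2)).hasFDerivAt.comp y h1
  have hpos := hδ.trans_le (le_sqrt_sq_add_sq δ (excess ε x y))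
  have h3 := ((h2.add_const (δ ^ 2)).sqrt (by
    show excess ε x y ^ 2 + δ ^ 2 ≠ 0
    positivity)).sub_const δ
  have h4 := (h3.const_add (ε ^ 2)).sqrt (by
    show ε ^ 2 + (√(excess ε x y ^ 2 + δ ^ 2) - δ) ≠ 0
    have := le_sqrt_sq_add_sq δ (excess ε x y)
    have : 0 < ε ^ 2 := by positivity
    linarith)
  have h5 : HasFDerivAt (truncDist ε δ x) _ y := h4
  refine h5.congr_fderiv ?_
  have hpos' := hε.trans_le (le_truncDist ε δ x y)
  ext v
  have e1 : √(ε ^ 2 + (√(excess ε x y ^ 2 + δ ^ 2) - δ)) = truncDist ε δ x y := rfl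
  have e2 : max (‖y - x‖ ^ 2 - ε ^ 2) 0 = excess ε x y := rfl
  simp only [Function.comp_apply, id_eq, e2, e1, truncSlope, FunLike.coe_smul,
    ContinuousLinearMap.coe_comp, Pi.smul_apply, smul_eq_mul]
  simp
  field_simp

theorem contDiff_truncDist {ε δ : ℝ} (hε : 0 < ε) (hδ : 0 < δ) (x : E3) :
    ContDiff ℝ 1 (truncDist ε δ x) := by
  rw [contDiff_one_iff_fderiv]
  refine ⟨fun y => (hasFDerivAt_truncDist hε hδ x y).differentiableAt, ?_⟩
  have h : fderiv ℝ (truncDist ε δ x) =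
      fun y => (truncSlope ε δ x y / truncDist ε δ x y) • innerSL ℝ (y - x) :=
    funext fun y => (hasFDerivAt_truncDist hε hδ x y).fderiv
  rw [h]
  have h1 : Continuous fun y => truncSlope ε δ x y / truncDist ε δ x y :=
    (continuous_truncSlope ε hδ x).div (continuous_truncDist ε δ x) fun y =>
      (hε.trans_le (le_truncDist ε δ x y)).ne'
  have h2 : Continuous fun y : E3 => innerSL ℝ (y - x) :=
    (innerSL ℝ (E := E3)).continuous.comp (continuous_id.sub continuous_const)
  exact h1.smul h2

/-- For `δ = 0` and `ε > 0` the truncated distance is the maximum of `ε` and `‖y - x‖`. -/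
theorem truncDist_zero_of_lt {ε : ℝ} (hε : 0 < ε) {x y : E3} (h : ε < ‖y - x‖) :
    truncDist ε 0 x y = ‖y - x‖ := by
  have h1 : 0 ≤ ‖y - x‖ ^ 2 - ε ^ 2 := by nlinarith
  rw [truncDist, excess, max_eq_left h1]
  simp [Real.sqrt_sq h1, Real.sqrt_sq]

theorem norm_le_truncDist_zero (ε : ℝ) (x y : E3) : ‖y - x‖ ≤ truncDist ε 0 x y := by
  refine Real.le_sqrt_of_sq_le ?_
  have h := le_max_left (‖y - x‖ ^ 2 - ε ^ 2) 0
  have h2 := excess_nonneg ε x y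
  simp only [ne_eq, OfNat.ofNat_ne_zero, not_false_eq_true, zero_pow, add_zero, sub_zero,
    Real.sqrt_sq h2]
  rw [excess]
  linarith

theorem tendsto_truncDist_delta (ε : ℝ) (x y : E3) :
    Tendsto (fun δ => truncDist ε δ x y) (𝓝[>] 0) (𝓝 (truncDist ε 0 x y)) := by
  have : Continuous fun δ => truncDist ε δ x y := by unfold truncDist; fun_prop
  exact (this.tendsto 0).mono_left nhdsWithin_le_nhds

/-- On the sphere `‖y - x‖ = ε` the slope is zero for every `δ > 0`, so the limit is the indicator
of the strict exterior, the domain of the truncated integral. -/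
theorem tendsto_truncSlope_delta {ε : ℝ} (hε : 0 < ε) (x y : E3) :
    Tendsto (fun δ => truncSlope ε δ x y) (𝓝[>] 0)
      (𝓝 ((Metric.closedBall x ε)ᶜ.indicator (fun _ => (1 : ℝ)) y)) := by
  by_cases h : y ∈ (Metric.closedBall x ε)ᶜ
  · have h' : ε < ‖y - x‖ := by simpa [dist_eq_norm] using h
    have hpos : 0 < excess ε x y := lt_max_of_lt_left (by nlinarith)
    have h1 : ContinuousAt (fun δ => truncSlope ε δ x y) 0 := by
      unfold truncSlope
      refine ContinuousAt.div continuousAt_const (by fun_prop) ?_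
      simp [Real.sqrt_sq hpos.le, hpos.ne']
    have h2 : truncSlope ε 0 x y = 1 := by
      simp [truncSlope, Real.sqrt_sq hpos.le, hpos.ne']
    rw [Set.indicator_of_mem h, ← h2]
    exact h1.tendsto.mono_left nhdsWithin_le_nhds
  · have h' : ‖y - x‖ ≤ ε := by simpa [dist_eq_norm] using h
    have h0 : excess ε x y = 0 := max_eq_right (by nlinarith [norm_nonneg (y - x)])
    rw [Set.indicator_of_notMem h]
    simp [truncSlope, h0]

theorem tendsto_truncDist_eps {x y : E3} :
    Tendsto (fun ε => truncDist ε 0 x y) (𝓝[>] 0) (𝓝 ‖y - x‖) := by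
  have h : Continuous fun ε => truncDist ε 0 x y := by
    unfold truncDist excess; fun_prop
  have h0 : truncDist 0 0 x y = ‖y - x‖ := by
    simp [truncDist, excess, Real.sqrt_sq]
  rw [← h0]
  exact (h.tendsto 0).mono_left nhdsWithin_le_nhds

/-! ### Integration by parts with a truncated kernel -/

section Cutoff

variable {Γ : Set E3} {τ : Fin 2 → E3 → E3}

theorem contDiff_radial_truncDist (κ : ℝ) {ε δ : ℝ} (hε : 0 < ε) (hδ : 0 < δ) (x : E3) :
    ContDiff ℝ 1 fun y => radial κ (truncDist ε δ x y) := by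
  have h1 : ContDiff ℝ 1 fun y => (truncDist ε δ x y : ℂ) :=
    Complex.ofRealCLM.contDiff.comp (contDiff_truncDist hε hδ x)
  simp only [radial, div_eq_mul_inv]
  refine ((contDiff_const.mul h1).cexp).mul ((contDiff_const.mul h1).inv fun y => ?_)
  have := (hε.trans_le (le_truncDist ε δ x y)).ne'
  simp [this, Real.pi_ne_zero]

theorem fderiv_radial_truncDist (κ : ℝ) {ε δ : ℝ} (hε : 0 < ε) (hδ : 0 < δ) (x y v : E3) :
    fderiv ℝ (fun y => radial κ (truncDist ε δ x y)) y v =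
      radialDeriv κ (truncDist ε δ x y) * truncSlope ε δ x y * (inner ℝ (y - x) v : ℝ) := by
  have hpos := (hε.trans_le (le_truncDist ε δ x y)).ne'
  have h := (hasDerivAt_radial κ hpos).hasFDerivAt.comp y (hasFDerivAt_truncDist hε hδ x y)
  have h1 : fderiv ℝ (fun y => radial κ (truncDist ε δ x y)) y = _ := h.fderiv
  have hc : (truncDist ε δ x y : ℂ) ≠ 0 := Complex.ofReal_ne_zero.2 hpos
  rw [h1, inner_sub_left]
  simp
  field_simp

theorem norm_radialDeriv_le_of_le {κ ε r : ℝ} (hκ : 0 < κ) (hε : 0 < ε) (hr : ε ≤ r) :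
    ‖radialDeriv κ r‖ ≤ (κ / ε ^ 2 + 1 / ε ^ 3) / (4 * Real.pi) := by
  have hr0 : 0 < r := hε.trans_le hr
  refine (norm_radialDeriv_le hκ hr0).trans ?_
  have : (κ * r + 1) / (4 * Real.pi * r ^ 3) = (κ / r ^ 2 + 1 / r ^ 3) / (4 * Real.pi) := by
    field_simp
  rw [this]
  gcongr

theorem norm_radial_le_of_le {ε r : ℝ} (κ : ℝ) (hε : 0 < ε) (hr : ε ≤ r) :
    ‖radial κ r‖ ≤ (4 * Real.pi)⁻¹ * ε⁻¹ := by
  rw [norm_radial κ (hε.le.trans hr)]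
  gcongr

/-- For `δ > 0` this is the divergence theorem for `J` multiplied by `σ` and a `C¹` kernel. As `δ →
0`, everything stays bounded because the truncated distance is at least `ε`, and the slope tends to
the indicator. -/
theorem truncated_integration_by_parts (hΓ : IsClosedC2Surface Γ) (hτ : IsTangentFrame Γ τ)
    {κ : ℝ} (hκ : 0 < κ) {σ : E3 → ℂ} (hσ : IsC1Along Γ σ) {J : E3 → E3} (hJ : IsC1Along Γ J)
    (hJt : ∀ y ∈ Γ, J y ∈ tangentPlane Γ y) (x : E3) {ε : ℝ} (hε : 0 < ε) :
    ∫ y, (radial κ (truncDist ε 0 x y) *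
        (σ y * (surfDiv Γ J y : ℂ) + surfDeriv Γ σ y (J y)) +
      radialDeriv κ (truncDist ε 0 x y) *
        ((Metric.closedBall x ε)ᶜ.indicator (fun _ => (1 : ℝ)) y : ℝ) *
        (σ y * (inner ℝ (y - x) (J y) : ℝ))) ∂area Γ = 0 := by
  have hfin := hΓ.isFiniteMeasure_area
  set A : E3 → ℂ := fun y => σ y * (surfDiv Γ J y : ℂ) + surfDeriv Γ σ y (J y) with hA
  set B : E3 → ℂ := fun y => σ y * (inner ℝ (y - x) (J y) : ℝ) with hB
  have hAc : ContinuousOn A Γ := (hσ.continuousOn.mul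
    (Complex.continuous_ofReal.comp_continuousOn hJ.continuousOn_surfDiv)).add
      (hσ.2.clm_apply hJ.continuousOn)
  have hBc : ContinuousOn B Γ := by
    have h1 : ContinuousOn (fun y : E3 => y - x) Γ := by fun_prop
    exact hσ.continuousOn.mul (Complex.continuous_ofReal.comp_continuousOn
      (h1.inner hJ.continuousOn))
  obtain ⟨CA, hCA⟩ := hΓ.isCompact.exists_bound_of_continuousOn hAc
  obtain ⟨CB, hCB⟩ := hΓ.isCompact.exists_bound_of_continuousOn hBc
  have hrc (δ : ℝ) : ∀ y ∈ Γ, truncDist ε δ x y ∈ ({0}ᶜ : Set ℝ) :=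
    fun y _ => (hε.trans_le (le_truncDist ε δ x y)).ne'
  have hlim := tendsto_integral_filter_of_dominated_convergence
    (μ := area Γ) (l := 𝓝[>] (0 : ℝ))
    (F := fun δ y => radial κ (truncDist ε δ x y) * A y +
      radialDeriv κ (truncDist ε δ x y) * truncSlope ε δ x y * B y)
    (f := fun y => radial κ (truncDist ε 0 x y) * A y + radialDeriv κ (truncDist ε 0 x y) *
        ((Metric.closedBall x ε)ᶜ.indicator (fun _ => (1 : ℝ)) y : ℝ) * B y)
    (fun _ => (4 * Real.pi)⁻¹ * ε⁻¹ * CA + (κ / ε ^ 2 + 1 / ε ^ 3) / (4 * Real.pi) * 1 * CB)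
    ?_ ?_ (integrable_const _) ?_
  · refine tendsto_nhds_unique hlim (tendsto_const_nhds.congr' ?_)
    filter_upwards [self_mem_nhdsWithin] with δ hδ
    have hδ0 : 0 < δ := hδ
    have hk := ContDiff.isC1Along hΓ hτ (contDiff_radial_truncDist κ hε hδ0 x)
    rw [← integral_div_eq_zero hΓ hτ hJ hJt (hk.mul hσ)]
    refine integral_congr_ae (ae_restrict_of_forall_mem hΓ.measurableSet fun y hy => ?_)
    simp only [surfDeriv_mul (hk.1 y hy) (hσ.1 y hy), add_apply, FunLike.coe_smul,
      Pi.smul_apply, smul_eq_mul]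
    rw [surfDeriv_apply_of_differentiableAt
      ((contDiff_radial_truncDist κ hε hδ0 x).differentiable one_ne_zero y) (hJt y hy),
      fderiv_radial_truncDist κ hε hδ0]
    simp only [hA, hB]
    ring
  · filter_upwards [self_mem_nhdsWithin] with δ hδ
    have hδ0 : 0 < δ := hδ
    have hTc := (continuous_truncDist ε δ x).continuousOn (s := Γ)
    have hc : ContinuousOn (fun y => radial κ (truncDist ε δ x y) * A y +
        radialDeriv κ (truncDist ε δ x y) * truncSlope ε δ x y * B y) Γ :=
      (((continuousOn_radial κ).comp hTc (hrc δ)).mul hAc).add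
      ((((continuousOn_radialDeriv κ).comp hTc (hrc δ)).mul
        (Complex.continuous_ofReal.comp (continuous_truncSlope ε hδ0 x)).continuousOn).mul hBc)
    exact hc.aestronglyMeasurable hΓ.measurableSet
  · filter_upwards [self_mem_nhdsWithin] with δ hδ
    have hδ0 : 0 < δ := hδ
    refine ae_restrict_of_forall_mem hΓ.measurableSet fun y hy => ?_
    refine (norm_add_le _ _).trans (add_le_add ?_ ?_)
    · rw [norm_mul]
      exact mul_le_mul (norm_radial_le_of_le κ hε (le_truncDist ε δ x y)) (hCA y hy)
        (norm_nonneg _) (by positivity)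
    · rw [norm_mul, norm_mul, Complex.norm_real, Real.norm_of_nonneg (truncSlope_nonneg ε δ x y)]
      exact mul_le_mul (mul_le_mul (norm_radialDeriv_le_of_le hκ hε (le_truncDist ε δ x y))
        (truncSlope_le_one ε δ x y) (truncSlope_nonneg ε δ x y) (by positivity)) (hCB y hy)
        (norm_nonneg _) (by positivity)
  · refine ae_restrict_of_forall_mem hΓ.measurableSet fun y hy => ?_
    have hne : truncDist ε 0 x y ∈ ({0}ᶜ : Set ℝ) := hrc 0 y hy
    have ht := tendsto_truncDist_delta ε x y
    have hopen := isOpen_compl_singleton.mem_nhds hne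
    exact (((((continuousOn_radial κ).continuousAt hopen).tendsto.comp ht).mul_const _).add
      (((((continuousOn_radialDeriv κ).continuousAt hopen).tendsto.comp ht).mul
        ((Complex.continuous_ofReal.tendsto _).comp (tendsto_truncSlope_delta hε x y))).mul_const _))

end Cutoff

/-! ### The gradient of the single layer potential -/

section Main

variable {Γ : Set E3} {τ : Fin 2 → E3 → E3}

/-- The bilinear dot product with a fixed real vector, as a continuous linear map. -/
noncomputable def cdotCLM (v : E3) : C3 →L[ℂ] ℂ :=
  ∑ j, (v j : ℂ) • EuclideanSpace.proj j

theorem cdotCLM_apply (v : E3) (w : C3) : cdotCLM v w = cdot v w := by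
  simp [cdotCLM, cdot]

theorem cdot_smul_toC (v w : E3) (z : ℂ) : cdot v (z • toC w) = z * (inner ℝ w v : ℝ) := by
  simp only [cdot, toC, PiLp.smul_apply, smul_eq_mul, inner_eq_sum, Fin.sum_univ_three]
  push_cast
  ring

theorem integrable_area_of_continuousOn (hΓ : IsClosedC2Surface Γ) {f : E3 → ℂ}
    (hf : ContinuousOn f Γ) : Integrable f (area Γ) := by
  have := hΓ.isFiniteMeasure_area
  obtain ⟨C, hC⟩ := hΓ.isCompact.exists_bound_of_continuousOn hf
  exact Integrable.mono' (integrable_const C) (hf.aestronglyMeasurable hΓ.measurableSet)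
    (ae_restrict_of_forall_mem hΓ.measurableSet hC)

theorem integrableOn_dGx (hΓ : IsClosedC2Surface Γ) {κ : ℝ} (hκ : 0 < κ) {σ : E3 → ℂ}
    (hσ : ContinuousOn σ Γ) (x a : E3) {ε : ℝ} (hε : 0 < ε) :
    IntegrableOn (fun y => dGx κ x y a * σ y) (Metric.closedBall x ε)ᶜ (area Γ) := by
  have hfin := hΓ.isFiniteMeasure_area
  have heq : ∀ y ∈ Γ \ {x}, dGx κ x y a * σ y =
      radialDeriv κ ‖x - y‖ * (-(inner ℝ (y - x) a : ℝ) * σ y) := fun y hy => by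
    rw [dGx_eq, dGy_eq κ hy.2]; ring
  have hB : ContinuousOn (fun y => -((inner ℝ (y - x) a : ℝ) : ℂ) * σ y) Γ := by
    have h1 : Continuous fun y : E3 => -((inner ℝ (y - x) a : ℝ) : ℂ) := by fun_prop
    exact h1.continuousOn.mul hσ
  obtain ⟨C, hC⟩ := hΓ.isCompact.exists_bound_of_continuousOn hB
  have hc : ContinuousOn (fun y => dGx κ x y a * σ y) (Γ \ {x}) :=
    ((continuousOn_radialDeriv_norm κ x).mul (hB.mono Set.sdiff_subset)).congr heq
  refine Integrable.mono' (integrable_const ((κ / ε ^ 2 + 1 / ε ^ 3) / (4 * Real.pi) * C))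
    (aestronglyMeasurable_area hΓ hc).restrict ?_
  filter_upwards [ae_restrict_mem Metric.isClosed_closedBall.measurableSet.compl,
    ae_restrict_of_ae (ae_area_mem_diff hΓ x)] with y hy hyΓ
  have hy' : ε < ‖x - y‖ := by simpa [dist_eq_norm, norm_sub_rev] using hy
  rw [heq y hyΓ, norm_mul]
  exact mul_le_mul (norm_radialDeriv_le_of_le hκ hε hy'.le) (hC y hyΓ.1) (norm_nonneg _)
    (by positivity)

/-- The truncated singular integral, rewritten with weakly singular kernels. -/
theorem setIntegral_dGx_eq (hΓ : IsClosedC2Surface Γ) (hτ : IsTangentFrame Γ τ) {κ : ℝ}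
    (hκ : 0 < κ) {σ : E3 → ℂ} (hσ : IsC1Along Γ σ) (x a : E3) {ε : ℝ} (hε : 0 < ε) :
    ∫ y in (Metric.closedBall x ε)ᶜ, dGx κ x y a * σ y ∂area Γ =
      ∫ y, (radial κ (truncDist ε 0 x y) * (σ y * (surfDiv Γ (tangential τ a) y : ℂ) +
          surfDeriv Γ σ y (tangential τ a y)) -
        (Metric.closedBall x ε)ᶜ.indicator
          (fun y => cdot a ((dGy κ x y (normal τ y) * σ y) • toC (normal τ y))) y) ∂area Γ := by
  have hm : MeasurableSet (Metric.closedBall x ε)ᶜ :=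
    Metric.isClosed_closedBall.measurableSet.compl
  have hJ := isC1Along_tangential hΓ hτ a
  have hrc : ∀ y ∈ Γ, truncDist ε 0 x y ∈ ({0}ᶜ : Set ℝ) :=
    fun y _ => (hε.trans_le (le_truncDist ε 0 x y)).ne'
  have hTc := (continuous_truncDist ε 0 x).continuousOn (s := Γ)
  have hP : Integrable (fun y => radial κ (truncDist ε 0 x y) *
      (σ y * (surfDiv Γ (tangential τ a) y : ℂ) + surfDeriv Γ σ y (tangential τ a y)))
      (area Γ) :=
    integrable_area_of_continuousOn hΓ (((continuousOn_radial κ).comp hTc hrc).mul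
      ((hσ.continuousOn.mul (Complex.continuous_ofReal.comp_continuousOn
        hJ.continuousOn_surfDiv)).add (hσ.2.clm_apply hJ.continuousOn)))
  have hQ : Integrable (fun y => radialDeriv κ (truncDist ε 0 x y) *
        ((Metric.closedBall x ε)ᶜ.indicator (fun _ => (1 : ℝ)) y : ℝ) *
        (σ y * (inner ℝ (y - x) (tangential τ a y) : ℝ))) (area Γ) := by
    have h1 : ContinuousOn (fun y : E3 => y - x) Γ := by fun_prop
    have h2 : Integrable (fun y => radialDeriv κ (truncDist ε 0 x y) *
        (σ y * (inner ℝ (y - x) (tangential τ a y) : ℝ))) (area Γ) :=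
      integrable_area_of_continuousOn hΓ (((continuousOn_radialDeriv κ).comp hTc hrc).mul
        (hσ.continuousOn.mul (Complex.continuous_ofReal.comp_continuousOn
          (h1.inner hJ.continuousOn))))
    refine (h2.indicator hm).congr (Eventually.of_forall fun y => ?_)
    by_cases hy : y ∈ (Metric.closedBall x ε)ᶜ
    · simp only [Set.indicator_of_mem hy]
      push_cast; ring
    · simp only [Set.indicator_of_notMem hy]
      push_cast; ring
  have hL := (integrable_indicator_iff hm).2 (integrableOn_dGx hΓ hκ hσ.continuousOn x a hε)
  have hibp := truncated_integration_by_parts hΓ hτ hκ hσ hJ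
    (fun y hy => tangential_mem_tangentPlane hΓ hτ hy a) x hε
  -- The zero added on the left is the integration by parts identity; the two sides then agree
  -- pointwise almost everywhere.
  rw [← integral_indicator hm, ← add_zero (integral _ _), ← hibp]
  refine (integral_add hL (hP.add hQ)).symm.trans (integral_congr_ae ?_)
  filter_upwards [ae_area_mem_diff hΓ x] with y hy
  by_cases hyB : y ∈ (Metric.closedBall x ε)ᶜ
  · have hy' : ε < ‖y - x‖ := by simpa [dist_eq_norm] using hyB
    simp only [Pi.add_apply, Set.indicator_of_mem hyB, truncDist_zero_of_lt hε hy', dGx_eq,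
      dGy_eq κ hy.2, cdot_smul_toC]
    -- Outside the ball the tangential part of the derivative cancels, which leaves only the normal
    -- component of `a`.
    have hin : inner ℝ (y - x) (tangential τ a y) =
        inner ℝ (y - x) a - inner ℝ (normal τ y) a * inner ℝ (y - x) (normal τ y) := by
      rw [tangential_eq hτ hy.1, inner_sub_right, inner_smul_right]
    rw [hin, norm_sub_rev x y]
    push_cast
    ring
  · simp only [Pi.add_apply, Set.indicator_of_notMem hyB]
    push_cast
    ring

/-- The principal value of the differentiated single layer potential. -/
theorem tendsto_setIntegral_dGx (hΓ : IsClosedC2Surface Γ) (hτ : IsTangentFrame Γ τ) {κ : ℝ}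
    (hκ : 0 < κ) {σ : E3 → ℂ} (hσ : IsC1Along Γ σ) {x : E3} (hx : x ∈ Γ) (a : E3) :
    Integrable (fun y => G κ x y * (surfDiv Γ (tangential τ a) y : ℂ) * σ y) (area Γ) ∧
    Integrable (fun y => G κ x y * cdot (tangential τ a y) (surfGrad Γ σ y)) (area Γ) ∧
    Integrable (fun y => (dGy κ x y (normal τ y) * σ y) • toC (normal τ y)) (area Γ) ∧
    Tendsto (fun ε : ℝ => ∫ y in (Metric.closedBall x ε)ᶜ, dGx κ x y a * σ y ∂(area Γ)) (𝓝[>] 0)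
      (𝓝 ((∫ y, G κ x y * (surfDiv Γ (tangential τ a) y : ℂ) * σ y ∂(area Γ))
        + (∫ y, G κ x y * cdot (tangential τ a y) (surfGrad Γ σ y) ∂(area Γ))
        - cdot a (∫ y, (dGy κ x y (normal τ y) * σ y) • toC (normal τ y) ∂(area Γ)))) := by
  have hJ := isC1Along_tangential hΓ hτ a
  have hGc := continuousOn_G (Γ := Γ) κ x
  have hdivc : ContinuousOn (fun y => (surfDiv Γ (tangential τ a) y : ℂ) * σ y) Γ :=
    (Complex.continuous_ofReal.comp_continuousOn hJ.continuousOn_surfDiv).mul hσ.continuousOn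
  have hgradc : ContinuousOn (fun y => cdot (tangential τ a y) (surfGrad Γ σ y)) Γ := by
    simp only [← surfDeriv_apply_eq_cdot]
    exact hσ.2.clm_apply hJ.continuousOn
  have hint {f : E3 → ℂ} (hf : ContinuousOn f Γ) :
      Integrable (fun y => G κ x y * f y) (area Γ) := by
    obtain ⟨C, hC⟩ := hΓ.isCompact.exists_bound_of_continuousOn hf
    refine integrable_of_norm_le_inv hΓ hx (M := (4 * Real.pi)⁻¹ * C)
      (hGc.mul (hf.mono Set.sdiff_subset)) fun y hy _ => ?_
    rw [norm_mul, norm_G]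
    calc _ ≤ (4 * Real.pi)⁻¹ * ‖x - y‖⁻¹ * C := by gcongr; exact hC y hy
      _ = _ := by ring
  have hI1 := hint hdivc
  have hI2 := hint hgradc
  obtain ⟨Cσ, hCσ⟩ := hΓ.isCompact.exists_bound_of_continuousOn hσ.continuousOn
  obtain ⟨M, hM⟩ := exists_norm_dGy_normal_le hΓ hτ hκ
  have hK : ∀ y ∈ Γ, y ≠ x → ‖(dGy κ x y (normal τ y) * σ y) • toC (normal τ y)‖ ≤
      M * Cσ * ‖x - y‖⁻¹ := fun y hy hyx => by
    rw [norm_smul, norm_toC, norm_normal hτ hy, mul_one, norm_mul]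
    have h1 := hM x hx y hy hyx
    calc _ ≤ M * ‖x - y‖⁻¹ * Cσ :=
          mul_le_mul h1 (hCσ y hy) (norm_nonneg _) ((norm_nonneg _).trans h1)
      _ = _ := by ring
  have hI3 : Integrable (fun y => (dGy κ x y (normal τ y) * σ y) • toC (normal τ y))
      (area Γ) := by
    refine integrable_of_norm_le_inv hΓ hx ?_ hK
    refine ((hσ.continuousOn.mono Set.sdiff_subset).smul
      (continuousOn_dGy_normal_smul_normal hΓ hτ κ x)).congr fun y _ => ?_
    rw [mul_comm, mul_smul]
    rfl
  have hW := (cdotCLM a).integrable_comp hI3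
  simp only [cdotCLM_apply] at hW
  refine ⟨by simpa only [mul_assoc] using hI1, hI2, hI3, ?_⟩
  set A : E3 → ℂ := fun y => σ y * (surfDiv Γ (tangential τ a) y : ℂ) +
    surfDeriv Γ σ y (tangential τ a y) with hA
  set W : E3 → ℂ := fun y => cdot a ((dGy κ x y (normal τ y) * σ y) • toC (normal τ y)) with hWdef
  have hAc : ContinuousOn A Γ := (hσ.continuousOn.mul
    (Complex.continuous_ofReal.comp_continuousOn hJ.continuousOn_surfDiv)).add
      (hσ.2.clm_apply hJ.continuousOn)
  obtain ⟨CA, hCA⟩ := hΓ.isCompact.exists_bound_of_continuousOn hAc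
  have hlimit : (∫ y, G κ x y * (surfDiv Γ (tangential τ a) y : ℂ) * σ y ∂(area Γ))
        + (∫ y, G κ x y * cdot (tangential τ a y) (surfGrad Γ σ y) ∂(area Γ))
        - cdot a (∫ y, (dGy κ x y (normal τ y) * σ y) • toC (normal τ y) ∂(area Γ)) =
      ∫ y, (G κ x y * A y - W y) ∂area Γ := by
    have h3 := (cdotCLM a).integral_comp_comm hI3
    simp only [cdotCLM_apply] at h3
    simp only [mul_assoc]
    rw [← h3, ← integral_add hI1 hI2]
    refine (integral_sub (hI1.add hI2) hW).symm.trans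
      (integral_congr_ae (Eventually.of_forall fun y => ?_))
    simp only [hA, hWdef, Pi.add_apply, surfDeriv_apply_eq_cdot]
    ring
  rw [hlimit]
  have hdom := tendsto_integral_filter_of_dominated_convergence
    (μ := area Γ) (l := 𝓝[>] (0 : ℝ))
    (F := fun ε y => radial κ (truncDist ε 0 x y) * A y -
      (Metric.closedBall x ε)ᶜ.indicator W y)
    (f := fun y => G κ x y * A y - W y)
    -- The truncated distance is at least `‖y - x‖`, so this majorant is independent of `ε`.
    (fun y => (4 * Real.pi)⁻¹ * CA * ‖x - y‖⁻¹ + ‖W y‖)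
    ?_ ?_ (((hΓ.integrable_norm_inv hx).const_mul _).add hW.norm) ?_
  · refine hdom.congr' ?_
    filter_upwards [self_mem_nhdsWithin] with ε hε
    exact (setIntegral_dGx_eq hΓ hτ hκ hσ x a hε).symm
  · filter_upwards [self_mem_nhdsWithin] with ε hε
    have hε0 : 0 < ε := hε
    have h1 : ContinuousOn (fun y => radial κ (truncDist ε 0 x y) * A y) Γ :=
      ((continuousOn_radial κ).comp (continuous_truncDist ε 0 x).continuousOn
        fun y _ => (hε0.trans_le (le_truncDist ε 0 x y)).ne').mul hAc
    exact (h1.aestronglyMeasurable hΓ.measurableSet).sub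
      (hW.aestronglyMeasurable.indicator Metric.isClosed_closedBall.measurableSet.compl)
  · refine Eventually.of_forall fun ε => ?_
    filter_upwards [ae_area_mem_diff hΓ x] with y hy
    refine (norm_sub_le _ _).trans (add_le_add ?_ (norm_indicator_le_norm_self W y))
    have hpos : 0 < ‖y - x‖ := norm_pos_iff.2 (sub_ne_zero.2 hy.2)
    rw [norm_mul, norm_sub_rev]
    calc _ ≤ (4 * Real.pi)⁻¹ * ‖y - x‖⁻¹ * CA :=
          mul_le_mul (norm_radial_le_of_le κ hpos (norm_le_truncDist_zero ε x y)) (hCA y hy.1)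
            (norm_nonneg _) (by positivity)
      _ = _ := by ring
  · filter_upwards [ae_area_mem_diff hΓ x] with y hy
    have hpos : 0 < ‖y - x‖ := norm_pos_iff.2 (sub_ne_zero.2 hy.2)
    have hr : Tendsto (fun ε => radial κ (truncDist ε 0 x y)) (𝓝[>] 0) (𝓝 (G κ x y)) := by
      rw [G_eq_radial, norm_sub_rev]
      exact (hasDerivAt_radial κ hpos.ne').continuousAt.tendsto.comp tendsto_truncDist_eps
    refine (hr.mul_const _).sub (tendsto_const_nhds.congr' ?_)
    filter_upwards [Ioo_mem_nhdsGT hpos] with ε hε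
    have hyB : y ∈ (Metric.closedBall x ε)ᶜ := by
      simpa [dist_eq_norm] using hε.2
    rw [Set.indicator_of_mem hyB]

end Main

end LayerPotential

theorem theorem1 (Γ : Set E3) (hΓ : IsClosedC2Surface Γ)
    (τ : Fin 2 → E3 → E3) (hτ : IsTangentFrame Γ τ) (κ : ℝ) (hκ : 0 < κ) :
    -- the fields whose surface divergence is taken are differentiable along the surface
    (∀ i, ∀ x ∈ Γ, ∀ y ∈ Γ, DifferentiableWithinAt ℝ (tangential τ (τ i x)) Γ y) ∧
    -- the kernels on the right-hand side are weakly singular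
    (∀ i, IsWeaklySingular Γ fun x y => G κ x y * (surfDiv Γ (tangential τ (τ i x)) y : ℂ)) ∧
    (∀ i, IsWeaklySingular Γ fun x y => G κ x y • toC (tangential τ (τ i x) y)) ∧
    (IsWeaklySingular Γ fun x y => dGy κ x y (normal τ y) • toC (normal τ y)) ∧
    ∀ (σ : E3 → ℂ) (α : ℝ), 0 < α → α < 1 → IsC1Holder Γ α σ → ∀ i, ∀ x ∈ Γ,
      -- all integrals involved converge absolutely
      (∀ ε > 0, IntegrableOn (fun y => dGx κ x y (τ i x) * σ y) (Metric.closedBall x ε)ᶜ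
        (area Γ)) ∧
      Integrable (fun y => G κ x y * (surfDiv Γ (tangential τ (τ i x)) y : ℂ) * σ y) (area Γ) ∧
      Integrable (fun y => G κ x y * cdot (tangential τ (τ i x) y) (surfGrad Γ σ y)) (area Γ) ∧
      Integrable (fun y => (dGy κ x y (normal τ y) * σ y) • toC (normal τ y)) (area Γ) ∧
      -- the left-hand side, a Cauchy principal value, exists and equals the right-hand side
      Tendsto (fun ε : ℝ =>
          ∫ y in (Metric.closedBall x ε)ᶜ, dGx κ x y (τ i x) * σ y ∂(area Γ))
        (𝓝[>] 0)
        (𝓝 ((∫ y, G κ x y * (surfDiv Γ (tangential τ (τ i x)) y : ℂ) * σ y ∂(area Γ))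
          + (∫ y, G κ x y * cdot (tangential τ (τ i x) y) (surfGrad Γ σ y) ∂(area Γ))
          - cdot (τ i x)
              (∫ y, (dGy κ x y (normal τ y) * σ y) • toC (normal τ y) ∂(area Γ)))) := by
  refine ⟨fun i x _ y hy => (isC1Along_tangential hΓ hτ _).1 y hy,
    isWeaklySingular_G_mul_surfDiv hΓ hτ κ, isWeaklySingular_G_smul_tangential hΓ hτ κ,
    isWeaklySingular_dGy_normal hΓ hτ hκ, fun σ α hα _ hσ i x hx => ?_⟩
  have hσ1 := hσ.isC1Along hα
  exact ⟨fun ε hε => integrableOn_dGx hΓ hκ hσ1.continuousOn x _ hε,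
    tendsto_setIntegral_dGx hΓ hτ hκ hσ1 hx (τ i x)⟩
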